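/- Conventions. Knots and links are unoriented and are given by planar diagrams; isotopy of diagrams is equality up to finitely many planar isotopies and Reidemeister moves (for tangle diagrams: relative to the endpoints). A $2$-tangle diagram has four endpoints NW, NE, SW, SE. Let $[0]$ be the tangle of two horizontal arcs, $[\infty]$ that of two vertical arcs, $[\pm1]$ the two one-crossing tangles; $T+S$ is $T$ and $S$ side by side, $T*S$ is $T$ on top of $S$, and $\frac1T$ is the mirror image of $T$ rotated counterclockwise by $90^\circ$. A tangle is \emph{rational} if it is isotopic to one created from $[0]$ or $[\infty]$ by finitely many additions of, and multiplications by, $[\pm1]$, on either side. The numerator closure $N(T)$ joins NW to NE and SW to SE; the denominator closure $D(T)$ joins NW to SW and NE to SE. A knot or link is \emph{rational} if it is isotopic to $N(T)$ or $D(T)$ for some rational tangle $T$. A diagram is \emph{alternating} if over- and undercrossings alternate along every arc and component; a knot or link is \emph{alternating} if it possesses an alternating diagram. For an integer $a$ let $[a]$ be the tangle of $|a|$ horizontal twists of the sign of $a$, and put $$[[\beta_1],[\beta_2],\dots,[\beta_m]]=[\beta_1]+\cfrac{1}{[\beta_2]+\cdots+\cfrac{1}{[\beta_m]}}.$$ A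 tangle is in \emph{canonical form} if it is $[[\beta_1],\dots,[\beta_m]]$ with $m$ odd and either $\beta_1\ge 0$ and $\beta_2,\dots,\beta_m>0$, or $\beta_1\le 0$ and $\beta_2,\dots,\beta_m<0$. Corollary 2. Every rational knot or link $L$ is alternating. More precisely, there is an alternating rational tangle diagram $T$ in canonical form such that $L$ is isotopic to $N(T)$ or to $D(T)$, and this closure of $T$ is an alternating diagram of $L$. -/

import Mathlib

/-- The elementary pieces from which diagrams in Morse position are built, read upwards:
a minimum `∪`, a maximum `∩`, and a crossing of two neighbouring strands.
In `cross true` the overcrossing strand runs from the upper left to the lower right,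
in `cross false` it runs from the lower left to the upper right. -/
inductive Piece : Type
  | cup : Piece
  | cap : Piece
  | cross (s : Bool) : Piece
  deriving DecidableEq

namespace Piece

/-- Number of strands entering a piece from below. -/
def inputs : Piece → ℕ
  | cup => 0
  | cap => 2
  | cross _ => 2

/-- Number of strands leaving a piece at the top. -/
def outputs : Piece → ℕ
  | cup => 2
  | cap => 0
  | cross _ => 2

/-- Switching a crossing. -/
def mirror : Piece → Piece
  | cup => cup
  | cap => cap
  | cross s => cross (!s)

end Piece

/-- A horizontal slice of a planar diagram: one elementary piece, with `left` vertical strands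
to the left of it (and any number of vertical strands to the right of it). -/
structure Slice : Type where
  piece : Piece
  left : ℕ
  deriving DecidableEq

/-- `Stacks n w m`: the slices in the list `w`, stacked from bottom to top, fit together to a
planar diagram with `n` endpoints at the bottom and `m` endpoints at the top. -/
inductive Stacks : ℕ → List Slice → ℕ → Prop
  | nil (n : ℕ) : Stacks n [] n
  | cons {n n' m : ℕ} (p : Piece) (i r : ℕ) (w : List Slice)
      (hn : n = i + p.inputs + r) (hn' : n' = i + p.outputs + r) (h : Stacks n' w m) :
      Stacks n (⟨p, i⟩ :: w) m

/-- Add `a` vertical strands to the left of a stack of slices. -/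
def shiftWord (a : ℕ) (w : List Slice) : List Slice :=
  w.map fun s => ⟨s.piece, a + s.left⟩

/-- Switch all the crossings in a stack of slices. -/
def mirrorWord (w : List Slice) : List Slice :=
  w.map fun s => ⟨s.piece.mirror, s.left⟩

theorem Stacks.append {n k m : ℕ} {u v : List Slice} (hu : Stacks n u k) (hv : Stacks k v m) :
    Stacks n (u ++ v) m := by
  induction hu with
  | nil n => exact hv
  | cons p i r w hn hn' _ ih => exact Stacks.cons p i r _ hn hn' (ih hv)

theorem Stacks.shift {n m : ℕ} {w : List Slice} (h : Stacks n w m) (a b : ℕ) :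
    Stacks (a + n + b) (shiftWord a w) (a + m + b) := by
  induction h with
  | nil n => exact Stacks.nil _
  | cons p i r w hn hn' _ ih =>
      exact Stacks.cons p (a + i) (r + b) _ (by omega) (by omega) ih

theorem Stacks.widen {n m : ℕ} {w : List Slice} (h : Stacks n w m) (b : ℕ) :
    Stacks (n + b) w (m + b) := by
  induction h with
  | nil n => exact Stacks.nil _
  | cons p i r w hn hn' _ ih =>
      exact Stacks.cons p i (r + b) _ (by omega) (by omega) ih

theorem Stacks.mirror {n m : ℕ} {w : List Slice} (h : Stacks n w m) :
    Stacks n (mirrorWord w) m := by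
  induction h with
  | nil n => exact Stacks.nil _
  | cons p i r w hn hn' _ ih =>
      refine Stacks.cons p.mirror i r _ ?_ ?_ ih
      · cases p <;> exact hn
      · cases p <;> exact hn'

theorem Stacks.cup {i r m : ℕ} {w : List Slice} (h : Stacks (i + 2 + r) w m) :
    Stacks (i + r) (⟨.cup, i⟩ :: w) m :=
  .cons .cup i r w rfl rfl h

theorem Stacks.cap {i r m : ℕ} {w : List Slice} (h : Stacks (i + r) w m) :
    Stacks (i + 2 + r) (⟨.cap, i⟩ :: w) m :=
  .cons .cap i r w rfl rfl h

/-- An unoriented planar diagram (in Morse position) in a box, with `n` endpoints on the bottom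
side and `m` endpoints on the top side. -/
structure Diagram (n m : ℕ) : Type where
  word : List Slice
  fits : Stacks n word m

/-- Diagrams of `2`-tangles; the endpoints are SW, SE at the bottom and NW, NE at the top. -/
abbrev TangleDiagram : Type := Diagram 2 2

/-- Diagrams of knots and links. -/
abbrev LinkDiagram : Type := Diagram 0 0

/-- The local moves: planar isotopies of diagrams in Morse position and Reidemeister moves. -/
inductive LocalMove : List Slice → List Slice → Prop
  /-- Planar isotopy: pieces lying side by side may be moved vertically past each other. -/
  | exchange (p q : Piece) (i k : ℕ) :
      LocalMove [⟨p, i⟩, ⟨q, i + p.outputs + k⟩] [⟨q, i + p.inputs + k⟩, ⟨p, i⟩]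
  /-- Planar isotopy: straightening a bent strand. -/
  | zigzag_left (i : ℕ) : LocalMove [⟨.cup, i⟩, ⟨.cap, i + 1⟩] []
  /-- Planar isotopy: straightening a bent strand. -/
  | zigzag_right (i : ℕ) : LocalMove [⟨.cup, i + 1⟩, ⟨.cap, i⟩] []
  /-- Planar isotopy: turning a crossing around a minimum. -/
  | slide_cup (s : Bool) (i : ℕ) :
      LocalMove [⟨.cup, i⟩, ⟨.cross s, i + 1⟩] [⟨.cup, i + 1⟩, ⟨.cross (!s), i⟩]
  /-- Planar isotopy: turning a crossing around a maximum. -/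
  | slide_cap (s : Bool) (i : ℕ) :
      LocalMove [⟨.cross s, i + 1⟩, ⟨.cap, i⟩] [⟨.cross (!s), i⟩, ⟨.cap, i + 1⟩]
  /-- First Reidemeister move, at a minimum. -/
  | reidemeister_one_cup (s : Bool) (i : ℕ) :
      LocalMove [⟨.cup, i⟩, ⟨.cross s, i⟩] [⟨.cup, i⟩]
  /-- First Reidemeister move, at a maximum. -/
  | reidemeister_one_cap (s : Bool) (i : ℕ) :
      LocalMove [⟨.cross s, i⟩, ⟨.cap, i⟩] [⟨.cap, i⟩]
  /-- Second Reidemeister move. -/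
  | reidemeister_two (s : Bool) (i : ℕ) :
      LocalMove [⟨.cross s, i⟩, ⟨.cross (!s), i⟩] []
  /-- Third Reidemeister move. -/
  | reidemeister_three (s : Bool) (i : ℕ) :
      LocalMove [⟨.cross s, i⟩, ⟨.cross s, i + 1⟩, ⟨.cross s, i⟩]
        [⟨.cross s, i + 1⟩, ⟨.cross s, i⟩, ⟨.cross s, i + 1⟩]

/-- Where one stands, and in which direction one looks, when walking along a strand of a diagram:
at the height between the first `level` slices and the rest, on the strand number `pos`
(counted from `0` on the left), going up or down. -/
structure WalkState : Type where
  level : ℕ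
  pos : ℕ
  up : Bool

/-- The four corners of a crossing. -/
inductive Corner : Type
  | sw | se | nw | ne
  deriving DecidableEq

namespace Corner

/-- Is the strand at this corner of the crossing `cross s` the overcrossing one? -/
def isOver (s : Bool) : Corner → Bool
  | sw => !s
  | ne => !s
  | se => s
  | nw => s

/-- The state in which one leaves through the corner `c` a crossing that is slice number `k`,
with `i` strands to the left. -/
def leaving (k i : ℕ) : Corner → WalkState
  | sw => ⟨k, i, false⟩
  | se => ⟨k, i + 1, false⟩
  | nw => ⟨k + 1, i, true⟩
  | ne => ⟨k + 1, i + 1, true⟩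

/-- The state in which one arrives through the corner `c` at a crossing that is slice number `k`,
with `i` strands to the left. -/
def arriving (k i : ℕ) : Corner → WalkState
  | sw => ⟨k, i, true⟩
  | se => ⟨k, i + 1, true⟩
  | nw => ⟨k + 1, i, false⟩
  | ne => ⟨k + 1, i + 1, false⟩

end Corner

namespace Diagram

variable {n m : ℕ}

/-- One walks along a strand through one slice, without passing through a crossing. -/
inductive WalkStep (D : Diagram n m) : WalkState → WalkState → Prop
  | left_up {k i : ℕ} {p : Piece} (j : ℕ) (hk : D.word[k]? = some ⟨p, i⟩) (hj : j < i) :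
      WalkStep D ⟨k, j, true⟩ ⟨k + 1, j, true⟩
  | left_down {k i : ℕ} {p : Piece} (j : ℕ) (hk : D.word[k]? = some ⟨p, i⟩) (hj : j < i) :
      WalkStep D ⟨k + 1, j, false⟩ ⟨k, j, false⟩
  | right_up {k i : ℕ} {p : Piece} (j : ℕ) (hk : D.word[k]? = some ⟨p, i⟩) :
      WalkStep D ⟨k, i + p.inputs + j, true⟩ ⟨k + 1, i + p.outputs + j, true⟩
  | right_down {k i : ℕ} {p : Piece} (j : ℕ) (hk : D.word[k]? = some ⟨p, i⟩) :
      WalkStep D ⟨k + 1, i + p.outputs + j, false⟩ ⟨k, i + p.inputs + j, false⟩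
  | cap_right {k i : ℕ} (hk : D.word[k]? = some ⟨.cap, i⟩) :
      WalkStep D ⟨k, i, true⟩ ⟨k, i + 1, false⟩
  | cap_left {k i : ℕ} (hk : D.word[k]? = some ⟨.cap, i⟩) :
      WalkStep D ⟨k, i + 1, true⟩ ⟨k, i, false⟩
  | cup_right {k i : ℕ} (hk : D.word[k]? = some ⟨.cup, i⟩) :
      WalkStep D ⟨k + 1, i, false⟩ ⟨k + 1, i + 1, true⟩
  | cup_left {k i : ℕ} (hk : D.word[k]? = some ⟨.cup, i⟩) :
      WalkStep D ⟨k + 1, i + 1, false⟩ ⟨k + 1, i, true⟩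

/-- A diagram is alternating if overcrossings and undercrossings alternate along every strand and
every component: whenever one leaves a crossing (through the corner `c`) and walks along the
strand to the next crossing (arriving at its corner `c'`), one passes over at exactly one of the
two. -/
def IsAlternating (D : Diagram n m) : Prop :=
  ∀ (k i k' i' : ℕ) (s s' : Bool) (c c' : Corner),
    D.word[k]? = some ⟨.cross s, i⟩ → D.word[k']? = some ⟨.cross s', i'⟩ →
    Relation.ReflTransGen D.WalkStep (c.leaving k i) (c'.arriving k' i') →
    c.isOver s ≠ c'.isOver s'

/-- `D'` arises from `D` by performing one local move somewhere in the diagram. -/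
def Move (D D' : Diagram n m) : Prop :=
  ∃ a u v b : List Slice, LocalMove u v ∧ D.word = a ++ u ++ b ∧ D'.word = a ++ v ++ b

/-- Isotopy of diagrams (relative to the endpoints): equality up to finitely many
planar isotopies and Reidemeister moves and their inverses. -/
def Isotopic : Diagram n m → Diagram n m → Prop :=
  Relation.EqvGen Move

end Diagram

namespace TangleDiagram

/-- The tangle `[0]`, two horizontal arcs. -/
def zero : TangleDiagram where
  word := [⟨.cap, 0⟩, ⟨.cup, 0⟩]
  fits := .cons _ _ 0 _ rfl rfl (.cons _ _ 0 _ rfl rfl (.nil _))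

/-- The tangle `[∞]`, two vertical arcs. -/
def infty : TangleDiagram where
  word := []
  fits := .nil _

/-- The tangles `[+1]` (for `s = true`) and `[-1]` (for `s = false`), a single crossing. -/
def one (s : Bool) : TangleDiagram where
  word := [⟨.cross s, 0⟩]
  fits := .cons _ _ 0 _ rfl rfl (.nil _)

/-- The sum `T + S`: `T` and `S` side by side, NE and SE of `T` joined to NW and SW of `S`. -/
def sum (T S : TangleDiagram) : TangleDiagram where
  word := ⟨.cup, 1⟩ :: (T.word ++ (shiftWord 2 S.word ++ [⟨.cap, 1⟩]))
  fits := Stacks.cup (i := 1) (r := 1) ((T.fits.widen 2).append ((S.fits.shift 2 0).append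
    (Stacks.cap (i := 1) (r := 1) (.nil 2))))

/-- The product `T * S`: `T` on top of `S`. -/
def prod (T S : TangleDiagram) : TangleDiagram where
  word := S.word ++ T.word
  fits := S.fits.append T.fits

/-- The mirror image `-T`: all crossings are switched. -/
def mirror (T : TangleDiagram) : TangleDiagram where
  word := mirrorWord T.word
  fits := T.fits.mirror

/-- The rotation of `T` counterclockwise by a right angle: NW, SW, SE, NE of the new tangle are
NE, NW, SW, SE of `T`. -/
def rotate (T : TangleDiagram) : TangleDiagram where
  word := ⟨.cup, 2⟩ :: (shiftWord 1 T.word ++ [⟨.cap, 0⟩])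
  fits := Stacks.cup (i := 2) (r := 0) ((T.fits.shift 1 1).append
    (Stacks.cap (i := 0) (r := 2) (.nil 2)))

/-- The inverse `1 / T`: the mirror image of `T`, rotated counterclockwise by a right angle. -/
def inverse (T : TangleDiagram) : TangleDiagram :=
  T.mirror.rotate

/-- The numerator closure: NW is joined to NE, and SW to SE. -/
def numerator (T : TangleDiagram) : LinkDiagram where
  word := ⟨.cup, 0⟩ :: (T.word ++ [⟨.cap, 0⟩])
  fits := Stacks.cup (i := 0) (r := 0) (T.fits.append (Stacks.cap (i := 0) (r := 0) (.nil 0)))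

/-- The denominator closure: NW is joined to SW, and NE to SE. -/
def denominator (T : TangleDiagram) : LinkDiagram where
  word := ⟨.cup, 0⟩ :: ⟨.cup, 2⟩ :: (shiftWord 1 T.word ++ [⟨.cap, 2⟩, ⟨.cap, 0⟩])
  fits := Stacks.cup (i := 0) (r := 0) (Stacks.cup (i := 2) (r := 0) ((T.fits.shift 1 1).append
    (Stacks.cap (i := 2) (r := 0) (Stacks.cap (i := 0) (r := 0) (.nil 0)))))

/-- Tangle diagrams in twist form: those created from `[0]` or `[∞]` by consecutive additions and
multiplications by `[±1]`, on either side. -/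
inductive IsTwistForm : TangleDiagram → Prop
  | zero : IsTwistForm zero
  | infty : IsTwistForm infty
  | sum_right (s : Bool) {T : TangleDiagram} (h : IsTwistForm T) : IsTwistForm (T.sum (one s))
  | sum_left (s : Bool) {T : TangleDiagram} (h : IsTwistForm T) : IsTwistForm ((one s).sum T)
  | prod_bottom (s : Bool) {T : TangleDiagram} (h : IsTwistForm T) : IsTwistForm (T.prod (one s))
  | prod_top (s : Bool) {T : TangleDiagram} (h : IsTwistForm T) : IsTwistForm ((one s).prod T)

/-- A tangle is rational if it is isotopic to a tangle in twist form. -/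
def IsRational (T : TangleDiagram) : Prop :=
  ∃ S : TangleDiagram, S.IsTwistForm ∧ T.Isotopic S

/-- The tangle of `n` horizontal twists, all equal to `[+1]` or all equal to `[-1]`. -/
def twists (s : Bool) : ℕ → TangleDiagram
  | 0 => zero
  | n + 1 => (twists s n).sum (one s)

/-- The integer tangle `[a]`. -/
def ofInt : ℤ → TangleDiagram
  | .ofNat n => twists true n
  | .negSucc n => twists false (n + 1)

/-- The continued fraction in integer tangles `[[a], [a₂], …, [aₙ]] = [a] + 1 / [[a₂], …, [aₙ]]`,
where `l = [a₂, …, aₙ]`. -/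
def contFrac (a : ℤ) : List ℤ → TangleDiagram
  | [] => ofInt a
  | b :: l => (ofInt a).sum (contFrac b l).inverse

/-- `T = [[β₁], …, [βₘ]]` with `m` odd and all terms positive or all terms negative, where, as
always for continued fractions, only the first term may be zero. (Here `l = [β₂, …, βₘ]`.) -/
def IsCanonicalForm (T : TangleDiagram) : Prop :=
  ∃ (b : ℤ) (l : List ℤ), T = contFrac b l ∧ Even l.length ∧
    ((0 ≤ b ∧ ∀ x ∈ l, 0 < x) ∨ (b ≤ 0 ∧ ∀ x ∈ l, x < 0))

end TangleDiagram

namespace LinkDiagram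

/-- A knot or link is rational if it is the numerator or the denominator closure of a rational
tangle. -/
def IsRational (L : LinkDiagram) : Prop :=
  ∃ T : TangleDiagram, T.IsRational ∧ (L.Isotopic T.numerator ∨ L.Isotopic T.denominator)

/-- A knot or link is alternating if it possesses an alternating diagram. -/
def IsAlternatingLink (L : LinkDiagram) : Prop :=
  ∃ K : LinkDiagram, L.Isotopic K ∧ K.IsAlternating

end LinkDiagram

/-! Gluing one crossing to a side of a tangle gives operations `top s`, `bottom s`, `right s`, `left
s` on tangles up to isotopy. Two relations hold for every tangle. Sliding a strand over or under the
whole tangle shows that a quarter turn amounts to gluing on three crossings: `rotCW x = top s (right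
(!s) (bottom s x))` (`rotCW_eq`). The third Reidemeister move gives the braid relation between `top
s` and `right (!s)` (`top_right_top`).

Comparing the rotated versions of the first relation yields, by induction, that on rational tangles
`top` agrees with `bottom` and `right` with `left` (`IsRat.isFlypable`). So only `top` and `right`
are needed, and `rotCW` is the three-letter word of the braid relation, for either choice of sign.

Every rational tangle can be built with crossings of a single sign (`IsRat.exists_isSigned`). A
glued crossing of the wrong sign either cancels the last crossing or meets one on the other side; in
that case `top (!s) (right s y) = rotCW (top s y)`, and a quarter turn converts a construction of
sign `s` into one of sign `!s`. A construction with one sign is read off as a continued fraction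
whose terms all have that sign, with an odd number of terms (`IsSigned.exists_signedFrac`). The
exception is `[∞]`, whose two closures are those of `[0]` interchanged.

Such a continued fraction is alternating because all its crossings look alike with respect to the
checkerboard colouring of the regions (`IsShaded.isAlternating`). This property survives sums,
inverses and both closures. -/

/-! ### Isotopy of stacks of slices -/

/-- The number of strands above a stack of slices with `n` strands below it, if they fit. -/
def strandsAbove : List Slice → ℕ → Option ℕ
  | [], n => some n
  | s :: w, n =>
      if s.left + s.piece.inputs ≤ n then strandsAbove w (n - s.piece.inputs + s.piece.outputs)
      else none

/-- For an explicit list of slices the hypothesis holds by computation, so that `rfl` proves that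
the slices fit. -/
theorem Stacks.of_strandsAbove {n m : ℕ} {w : List Slice} (h : strandsAbove w n = some m) : Stacks n w m := by
  induction w generalizing n with
  | nil => cases h; exact .nil _
  | cons s w ih =>
      rw [strandsAbove] at h
      split at h
      · next hs =>
          exact .cons s.piece s.left (n - s.piece.inputs - s.left) w (by omega) (by omega) (ih h)
      · cases h

/-- Isotopy of stacks of slices with `n` strands at the bottom and `m` strands at the top. -/
def WordIso (n : ℕ) (u v : List Slice) (m : ℕ) : Prop :=
  ∃ (hu : Stacks n u m) (hv : Stacks n v m), Diagram.Isotopic (⟨u, hu⟩ : Diagram n m) ⟨v, hv⟩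

theorem shiftWord_append (a : ℕ) (u v : List Slice) :
    shiftWord a (u ++ v) = shiftWord a u ++ shiftWord a v := List.map_append

theorem shiftWord_shiftWord (a b : ℕ) (u : List Slice) :
    shiftWord a (shiftWord b u) = shiftWord (a + b) u := by
  simp [shiftWord, add_assoc]

theorem shiftWord_zero (u : List Slice) : shiftWord 0 u = u := by
  simp [shiftWord]

theorem mirrorWord_append (u v : List Slice) :
    mirrorWord (u ++ v) = mirrorWord u ++ mirrorWord v := List.map_append

theorem LocalMove.shift {u v : List Slice} (h : LocalMove u v) (a : ℕ) :
    LocalMove (shiftWord a u) (shiftWord a v) := by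
  cases h with
  | exchange p q i k =>
      have := LocalMove.exchange p q (a + i) k
      simpa only [shiftWord, List.map, add_assoc] using this
  | zigzag_left i => exact LocalMove.zigzag_left (a + i)
  | zigzag_right i => exact LocalMove.zigzag_right (a + i)
  | slide_cup s i => exact LocalMove.slide_cup s (a + i)
  | slide_cap s i => exact LocalMove.slide_cap s (a + i)
  | reidemeister_one_cup s i => exact LocalMove.reidemeister_one_cup s (a + i)
  | reidemeister_one_cap s i => exact LocalMove.reidemeister_one_cap s (a + i)
  | reidemeister_two s i => exact LocalMove.reidemeister_two s (a + i)
  | reidemeister_three s i => exact LocalMove.reidemeister_three s (a + i)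

theorem Piece.inputs_mirror (p : Piece) : p.mirror.inputs = p.inputs := by cases p <;> rfl

theorem Piece.outputs_mirror (p : Piece) : p.mirror.outputs = p.outputs := by cases p <;> rfl

theorem LocalMove.mirror {u v : List Slice} (h : LocalMove u v) :
    LocalMove (mirrorWord u) (mirrorWord v) := by
  cases h with
  | exchange p q i k =>
      have := LocalMove.exchange p.mirror q.mirror i k
      rwa [Piece.inputs_mirror, Piece.outputs_mirror] at this
  | zigzag_left i => exact LocalMove.zigzag_left i
  | zigzag_right i => exact LocalMove.zigzag_right i
  | slide_cup s i => exact LocalMove.slide_cup (!s) i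
  | slide_cap s i => exact LocalMove.slide_cap (!s) i
  | reidemeister_one_cup s i => exact LocalMove.reidemeister_one_cup (!s) i
  | reidemeister_one_cap s i => exact LocalMove.reidemeister_one_cap (!s) i
  | reidemeister_two s i => exact LocalMove.reidemeister_two (!s) i
  | reidemeister_three s i => exact LocalMove.reidemeister_three (!s) i

namespace WordIso

variable {n m k l : ℕ} {u v w : List Slice}

theorem refl (hu : Stacks n u m) : WordIso n u u m := ⟨hu, hu, .refl _⟩

theorem symm (h : WordIso n u v m) : WordIso n v u m :=
  ⟨h.2.1, h.1, .symm _ _ h.2.2⟩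

theorem trans (h : WordIso n u v m) (h' : WordIso n v w m) : WordIso n u w m :=
  ⟨h.1, h'.2.1, .trans _ _ _ h.2.2 h'.2.2⟩

theorem of_isotopic {D D' : Diagram n m} (h : D.Isotopic D') : WordIso n D.word D'.word m :=
  ⟨D.fits, D'.fits, h⟩

theorem isotopic {D D' : Diagram n m} (h : WordIso n D.word D'.word m) : D.Isotopic D' :=
  h.2.2

/-- An operation on words respects isotopy as soon as it carries a local move inside a context to a
local move inside a context. Shifting, widening, mirroring and stacking are all instances. -/
theorem of_map {n' m' : ℕ} (f : List Slice → List Slice)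
    (hf : ∀ {w}, Stacks n w m → Stacks n' (f w) m')
    (hm : ∀ a u v b, LocalMove u v → ∃ a' u' v' b', LocalMove u' v' ∧
      f (a ++ u ++ b) = a' ++ u' ++ b' ∧ f (a ++ v ++ b) = a' ++ v' ++ b')
    (h : WordIso n u v m) : WordIso n' (f u) (f v) m' := by
  obtain ⟨hu, hv, h⟩ := h
  suffices ∀ D D' : Diagram n m, D.Isotopic D' → WordIso n' (f D.word) (f D'.word) m' from
    this _ _ h
  intro D D' h
  induction h with
  | rel D D' h =>
      obtain ⟨a, u, v, b, hl, h₁, h₂⟩ := h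
      obtain ⟨a', u', v', b', hl', h₁', h₂'⟩ := hm a u v b hl
      exact ⟨hf D.fits, hf D'.fits, .rel _ _
        ⟨a', u', v', b', hl', by rw [← h₁', ← h₁], by rw [← h₂', ← h₂]⟩⟩
  | refl D => exact refl (hf D.fits)
  | symm D D' _ ih => exact ih.symm
  | trans D D' D'' _ _ ih ih' => exact ih.trans ih'

theorem shift (h : WordIso n u v m) (a b : ℕ) :
    WordIso (a + n + b) (shiftWord a u) (shiftWord a v) (a + m + b) :=
  h.of_map _ (fun h => h.shift a b) fun x u v y hl =>
    ⟨shiftWord a x, shiftWord a u, shiftWord a v, shiftWord a y, hl.shift a,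
      by simp only [shiftWord_append], by simp only [shiftWord_append]⟩

theorem widen (h : WordIso n u v m) (b : ℕ) : WordIso (n + b) u v (m + b) :=
  h.of_map id (fun h => h.widen b) fun x u v y hl => ⟨x, u, v, y, hl, rfl, rfl⟩

theorem mirror (h : WordIso n u v m) : WordIso n (mirrorWord u) (mirrorWord v) m :=
  h.of_map _ (fun h => h.mirror) fun x u v y hl =>
    ⟨mirrorWord x, mirrorWord u, mirrorWord v, mirrorWord y, hl.mirror,
      by simp only [mirrorWord_append], by simp only [mirrorWord_append]⟩

theorem append {u' v' : List Slice} (h : WordIso n u u' k) (h' : WordIso k v v' m) :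
    WordIso n (u ++ v) (u' ++ v') m := by
  have h₁ : WordIso n (u ++ v) (u' ++ v) m :=
    h.of_map (· ++ v) (fun hu => hu.append h'.1) fun x u₁ v₁ y hl =>
      ⟨x, u₁, v₁, y ++ v, hl, by simp, by simp⟩
  have h₂ : WordIso n (u' ++ v) (u' ++ v') m :=
    h'.of_map (u' ++ ·) (fun hu => h.2.1.append hu) fun x u₁ v₁ y hl =>
      ⟨u' ++ x, u₁, v₁, y, hl, by simp, by simp⟩
  exact h₁.trans h₂

theorem context {a b : List Slice} (ha : Stacks n a k) (h : WordIso k u v l)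
    (hb : Stacks l b m) : WordIso n (a ++ u ++ b) (a ++ v ++ b) m :=
  ((refl ha).append h).append (refl hb)

theorem of_move (a b : List Slice) (h : LocalMove u v) (hu : Stacks n (a ++ u ++ b) m)
    (hv : Stacks n (a ++ v ++ b) m) : WordIso n (a ++ u ++ b) (a ++ v ++ b) m :=
  ⟨hu, hv, .rel _ _ ⟨a, u, v, b, h, rfl, rfl⟩⟩

/-- A local move in a context, where it is checked by computation that the slices fit. -/
theorem move (a b : List Slice) (h : LocalMove u v) (hu : strandsAbove (a ++ u ++ b) n = some m)
    (hv : strandsAbove (a ++ v ++ b) n = some m) : WordIso n (a ++ u ++ b) (a ++ v ++ b) m :=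
  of_move a b h (.of_strandsAbove hu) (.of_strandsAbove hv)

theorem of_localMove (h : LocalMove u v) (hu : Stacks n u m) (hv : Stacks n v m) :
    WordIso n u v m :=
  ⟨hu, hv, .rel _ _ ⟨[], u, v, [], h, by simp, by simp⟩⟩

theorem exchange (p q : Piece) (i k r : ℕ) {N M x y : ℕ} (hN : N = i + p.inputs + k + q.inputs + r)
    (hM : M = i + p.outputs + k + q.outputs + r) (hx : x = i + p.outputs + k)
    (hy : y = i + p.inputs + k) : WordIso N [⟨p, i⟩, ⟨q, x⟩] [⟨q, y⟩, ⟨p, i⟩] M := by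
  subst hx hy
  exact of_localMove (.exchange p q i k)
    (.cons p i (k + q.inputs + r) _ (by omega) rfl (.cons q _ r _ (by omega) hM (.nil _)))
    (.cons q _ r _ hN rfl (.cons p i (k + q.outputs + r) _ (by omega) (by omega) (.nil _)))

/-- A piece to the right of a stack of slices may be moved below it. -/
theorem exchange_right (hw : Stacks n w m) (q : Piece) (a k r : ℕ) {N M x y : ℕ}
    (hN : N = a + n + k + q.inputs + r) (hM : M = a + m + k + q.outputs + r)
    (hx : x = a + m + k) (hy : y = a + n + k) :
    WordIso N (shiftWord a w ++ [⟨q, x⟩]) (⟨q, y⟩ :: shiftWord a w) M := by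
  induction hw generalizing N y with
  | nil n =>
      subst hx hy
      exact refl (.cons q _ r _ hN hM (.nil _))
  | cons p i j w hn hn' h ih =>
      rename_i n n' m
      have h₁ : WordIso N [⟨p, a + i⟩, ⟨q, a + n' + k⟩] [⟨q, y⟩, ⟨p, a + i⟩] _ :=
        exchange p q (a + i) (j + k) r (by omega) rfl (by omega) (by omega)
      have h₂ : WordIso N [⟨p, a + i⟩] [⟨p, a + i⟩] (a + n' + k + q.inputs + r) :=
        refl (.cons p (a + i) (j + k + q.inputs + r) [] (by omega) (by omega) (.nil _))
      have h₃ : Stacks (a + i + p.outputs + (j + k) + q.outputs + r) (shiftWord a w) M := by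
        have := h.shift a (k + q.outputs + r)
        convert this using 1 <;> omega
      exact (h₂.append (ih (by omega) (by omega) (by omega) (by omega))).trans (h₁.append (refl h₃))

/-- A piece to the left of a stack of slices may be moved above it. -/
theorem exchange_left (hw : Stacks n w m) (p : Piece) (i k r : ℕ) {N M x y : ℕ}
    (hN : N = i + p.inputs + k + n + r) (hM : M = i + p.outputs + k + m + r)
    (hx : x = i + p.outputs + k) (hy : y = i + p.inputs + k) :
    WordIso N (⟨p, i⟩ :: shiftWord x w) (shiftWord y w ++ [⟨p, i⟩]) M := by
  induction hw generalizing N with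
  | nil n => exact refl (.cons p i (k + n + r) _ (by omega) (by omega) (.nil _))
  | cons q j l w hn hn' h ih =>
      have h₁ : WordIso N [⟨p, i⟩, ⟨q, x + j⟩] [⟨q, y + j⟩, ⟨p, i⟩] _ :=
        exchange p q i (k + j) (l + r) (by omega) rfl (by omega) (by omega)
      have h₂ : WordIso N [⟨q, y + j⟩] [⟨q, y + j⟩] _ :=
        refl (.cons q (y + j) (l + r) [] (by omega) rfl (.nil _))
      have h₃ : Stacks (i + p.outputs + (k + j) + q.outputs + (l + r)) (shiftWord x w) M := by
        have := h.shift x r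
        convert this using 1 <;> omega
      exact (h₁.append (refl h₃)).trans (h₂.append (ih (by omega) (by omega)))

/-! ### Sliding a strand across a diagram -/

/-- The strand at position `n` passes all the strands on its left. -/
def passing (s : Bool) : ℕ → List Slice
  | 0 => []
  | n + 1 => ⟨.cross s, n⟩ :: passing s n

theorem stacks_passing (s : Bool) (n r : ℕ) : Stacks (n + 1 + r) (passing s n) (n + 1 + r) := by
  induction n generalizing r with
  | zero => exact .nil _
  | succ n ih =>
      have : Stacks (n + 2 + r) (passing s n) (n + 2 + r) := by
        convert ih (r + 1) using 1 <;> omega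
      exact .cons _ n r _ rfl rfl this

theorem passing_add (s : Bool) (i k : ℕ) :
    passing s (i + k) = shiftWord i (passing s k) ++ passing s i := by
  induction k with
  | zero => rfl
  | succ k ih => exact congrArg (List.cons _) ih

/-- A strand may be moved across a single piece. -/
theorem passing_piece (s : Bool) (p : Piece) :
    WordIso (p.inputs + 1) (⟨p, 0⟩ :: passing s p.outputs) (passing s p.inputs ++ [⟨p, 1⟩])
      (p.outputs + 1) := by
  match p with
  | .cup =>
      cases s
      · exact (move [] [⟨.cross false, 0⟩] (.slide_cup false 0) rfl rfl).trans
          (move [⟨.cup, 1⟩] [] (.reidemeister_two true 0) rfl rfl)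
      · exact (move [] [⟨.cross true, 0⟩] (.slide_cup true 0) rfl rfl).trans
          (move [⟨.cup, 1⟩] [] (.reidemeister_two false 0) rfl rfl)
  | .cap =>
      cases s
      · exact (WordIso.trans (move [⟨.cross false, 1⟩] [] (.slide_cap true 0) rfl rfl).symm
          (move [] [⟨.cap, 0⟩] (.reidemeister_two false 1) rfl rfl)).symm
      · exact (WordIso.trans (move [⟨.cross true, 1⟩] [] (.slide_cap false 0) rfl rfl).symm
          (move [] [⟨.cap, 0⟩] (.reidemeister_two true 1) rfl rfl)).symm
  | .cross t =>
      have h (s : Bool) : WordIso 3 [⟨.cross s, 0⟩, ⟨.cross s, 1⟩, ⟨.cross s, 0⟩]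
        [⟨.cross s, 1⟩, ⟨.cross s, 0⟩, ⟨.cross s, 1⟩] 3 :=
        move [] [] (.reidemeister_three s 0) rfl rfl
      -- The third Reidemeister move is given only for three equal signs. The mixed case is obtained
      -- by inserting a cancelling pair at the end, applying the equal-sign move, and cancelling a
      -- pair at the beginning.
      have h' (s t : Bool) (hst : t = !s) : WordIso 3 [⟨.cross t, 0⟩, ⟨.cross s, 1⟩, ⟨.cross s, 0⟩]
          [⟨.cross s, 1⟩, ⟨.cross s, 0⟩, ⟨.cross t, 1⟩] 3 := by
        have h₁ : WordIso 3 [⟨.cross t, 0⟩, ⟨.cross s, 1⟩, ⟨.cross s, 0⟩]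
            [⟨.cross t, 0⟩, ⟨.cross s, 1⟩, ⟨.cross s, 0⟩, ⟨.cross s, 1⟩, ⟨.cross t, 1⟩] 3 := by
          subst hst
          exact (move [⟨.cross _, 0⟩, ⟨.cross s, 1⟩, ⟨.cross s, 0⟩] []
            (.reidemeister_two s 1) rfl rfl).symm
        have h₂ : WordIso 3
            [⟨.cross t, 0⟩, ⟨.cross s, 0⟩, ⟨.cross s, 1⟩, ⟨.cross s, 0⟩, ⟨.cross t, 1⟩]
            [⟨.cross s, 1⟩, ⟨.cross s, 0⟩, ⟨.cross t, 1⟩] 3 := by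
          obtain rfl : s = !t := by simp [hst]
          exact move [] [⟨.cross _, 1⟩, ⟨.cross _, 0⟩, ⟨.cross t, 1⟩]
            (.reidemeister_two t 0) rfl rfl
        exact h₁.trans ((context (a := [⟨.cross t, 0⟩]) (b := [⟨.cross t, 1⟩]) (.of_strandsAbove rfl)
          (h s).symm (.of_strandsAbove rfl)).trans h₂)
      cases s <;> cases t
      · exact h false
      · exact h' false true rfl
      · exact h' true false rfl
      · exact h true

/-- A strand may be moved across a single slice. -/
theorem passing_slice (s : Bool) (p : Piece) (i r : ℕ) :
    WordIso (i + p.inputs + r + 1) (⟨p, i⟩ :: passing s (i + p.outputs + r))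
      (passing s (i + p.inputs + r) ++ [⟨p, i + 1⟩]) (i + p.outputs + r + 1) := by
  -- The passing strand is cut into three: the parts crossing the strands to the right of the piece,
  -- those attached to the piece, and those to the left. Only the middle part needs `passing_piece`;
  -- the outer parts commute with the piece by exchange.
  have hadd (j : ℕ) : passing s (i + j + r) =
      shiftWord (i + j) (passing s r) ++ shiftWord i (passing s j) ++ passing s i := by
    rw [passing_add, passing_add, List.append_assoc]
  have h₁ : WordIso (i + p.inputs + r + 1) (⟨p, i⟩ :: shiftWord (i + p.outputs) (passing s r))
      (shiftWord (i + p.inputs) (passing s r) ++ [⟨p, i⟩]) (i + p.outputs + r + 1) :=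
    exchange_left (stacks_passing s r 0) p i 0 0 rfl rfl rfl rfl
  have h₂ : WordIso (i + p.inputs + 1 + r)
      (⟨p, i⟩ :: shiftWord i (passing s p.outputs))
      (shiftWord i (passing s p.inputs) ++ [⟨p, i + 1⟩]) (i + p.outputs + 1 + r) := by
    simpa [shiftWord, add_assoc] using (passing_piece s p).shift i r
  have h₃ : WordIso (i + p.inputs + 1 + r) (⟨p, i + 1⟩ :: passing s i)
      (passing s i ++ [⟨p, i + 1⟩]) (i + p.outputs + 1 + r) := by
    have := (exchange_right (stacks_passing s i 0) p 0 0 r (N := i + p.inputs + 1 + r)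
      (M := i + p.outputs + 1 + r) (by omega) (by omega) rfl rfl).symm
    simpa only [shiftWord_zero, Nat.zero_add, Nat.add_zero] using this
  have e (j : ℕ) : i + j + r + 1 = i + j + 1 + r := by omega
  have s₁ (j : ℕ) : Stacks (i + j + 1 + r) (shiftWord (i + j) (passing s r)) (i + j + 1 + r) := by
    have := (stacks_passing s r 0).shift (i + j) 0
    convert this using 1 <;> omega
  have s₂ (j : ℕ) : Stacks (i + j + 1 + r) (shiftWord i (passing s j)) (i + j + 1 + r) :=
    (stacks_passing s j 0).shift i r
  have s₃ (j : ℕ) : Stacks (i + j + 1 + r) (passing s i) (i + j + 1 + r) := by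
    have := stacks_passing s i (j + r)
    convert this using 1 <;> omega
  rw [hadd, hadd]
  rw [e, e] at h₁ ⊢
  have t₁ := h₁.append (refl ((s₂ p.outputs).append (s₃ _)))
  have t₂ := (refl (s₁ p.inputs)).append (h₂.append (refl (s₃ _)))
  have t₃ := (refl ((s₁ p.inputs).append (s₂ _))).append h₃
  simp only [List.append_assoc, List.cons_append, List.nil_append] at t₁ t₂ t₃ ⊢
  exact t₁.trans (t₂.trans t₃)

/-- A strand may be moved across a stack of slices. -/
theorem passing_comm (s : Bool) (hw : Stacks n w m) :
    WordIso (n + 1) (w ++ passing s m) (passing s n ++ shiftWord 1 w) (m + 1) := by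
  induction hw with
  | nil n => simpa [shiftWord] using refl (stacks_passing s n 0)
  | cons p i r w hn hn' h ih =>
      rename_i m
      subst hn hn'
      have h₁ : Stacks (i + p.inputs + r + 1) [⟨p, i⟩] (i + p.outputs + r + 1) :=
        .cons p i (r + 1) _ rfl rfl (.nil _)
      have h₂ : Stacks (i + p.outputs + r + 1) (shiftWord 1 w) (m + 1) := by
        have := h.shift 1 0
        rwa [Nat.add_zero, Nat.add_zero, Nat.add_comm 1, Nat.add_comm 1] at this
      have := ((refl h₁).append ih).trans ((passing_slice s p i r).append (refl h₂))
      simpa [shiftWord, add_comm 1] using this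

end WordIso

/-! ### Explicit isotopies of tangle diagrams -/

namespace WordIso

variable {n m k : ℕ} {a u v t b : List Slice}

theorem prepend (a : List Slice) (h : WordIso k u v m)
    (ha : strandsAbove a n = some k := by rfl) : WordIso n (a ++ u) (a ++ v) m :=
  (refl (.of_strandsAbove ha)).append h

theorem above (ht : Stacks n t k) (h : WordIso k u v m) : WordIso n (t ++ u) (t ++ v) m :=
  (refl ht).append h

theorem below (h : WordIso n u v k) (ht : Stacks k t m) : WordIso n (u ++ t) (v ++ t) m :=
  h.append (refl ht)

/-- A tangle has two strands at both ends, so the piece on its right keeps its position. With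
numerical positions the default tactics settle the side conditions. -/
theorem tangle_right {N M x y c : ℕ} {q : Piece} (ht : Stacks 2 t 2)
    (hb : Stacks (N - q.inputs + q.outputs) b M := by exact .of_strandsAbove rfl)
    (hx : c + 2 ≤ x := by simp) (hy : x = y := by rfl)
    (hN : x + q.inputs ≤ N := by simp [Piece.inputs]) :
    WordIso N (shiftWord c t ++ (⟨q, x⟩ :: b)) (⟨q, y⟩ :: (shiftWord c t ++ b)) M := by
  subst hy
  have := (exchange_right ht q c (x - (c + 2)) (N - (x + q.inputs)) (N := N)
    (M := N - q.inputs + q.outputs) (x := x) (y := x)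
    (by omega) (by omega) (by omega) (by omega)).below hb
  simpa only [List.append_assoc, List.cons_append, List.nil_append] using this

theorem tangle_left {N M x y i : ℕ} {p : Piece} (ht : Stacks 2 t 2)
    (hb : Stacks (N - p.inputs + p.outputs) b M := by exact .of_strandsAbove rfl)
    (hx : i + p.outputs ≤ x := by simp [Piece.outputs])
    (hy : y + p.outputs = x + p.inputs := by rfl)
    (hN : y + 2 ≤ N := by simp) :
    WordIso N (⟨p, i⟩ :: (shiftWord x t ++ b)) (shiftWord y t ++ (⟨p, i⟩ :: b)) M := by
  have := (exchange_left ht p i (x - (i + p.outputs)) (N - (y + 2)) (N := N)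
    (M := N - p.inputs + p.outputs) (x := x) (y := y)
    (by omega) (by omega) (by omega) (by omega)).below hb
  simpa only [List.append_assoc, List.cons_append, List.nil_append] using this

end WordIso

namespace TangleDiagram

open WordIso

variable (s : Bool) {t : List Slice}

/-- Rotation clockwise by a right angle. -/
def rotateCW (T : TangleDiagram) : TangleDiagram where
  word := ⟨.cup, 0⟩ :: (shiftWord 1 T.word ++ [⟨.cap, 2⟩])
  fits := Stacks.cup (i := 0) (r := 2) ((T.fits.shift 1 1).append
    (Stacks.cap (i := 2) (r := 0) (.nil 2)))

local notation "𝐔" => Slice.mk Piece.cup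
local notation "𝐀" => Slice.mk Piece.cap
local notation:max "𝐗" s:max => Slice.mk (Piece.cross s)

/-- Two opposite quarter turns leave one bent strand on either side of the tangle; each is
straightened by a zigzag. -/
theorem rotateCW_rotate_word (ht : Stacks 2 t 2) :
    WordIso 2 (𝐔 0 :: 𝐔 3 :: (shiftWord 2 t ++ [𝐀 1, 𝐀 2])) t 2 := by
  refine trans (v := 𝐔 0 :: 𝐔 3 :: (shiftWord 2 t ++ [𝐀 4, 𝐀 1]))
    (prepend [𝐔 0, 𝐔 3] (above (ht.shift 2 2) (move [] [] (.exchange .cap .cap 1 1) rfl rfl))) ?_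
  refine trans (v := 𝐔 0 :: 𝐔 3 :: 𝐀 4 :: (shiftWord 2 t ++ [𝐀 1]))
    (prepend [𝐔 0, 𝐔 3] (tangle_right (N := 6) ht)) ?_
  refine trans (v := 𝐔 0 :: (shiftWord 2 t ++ [𝐀 1]))
    (below (move [𝐔 0] [] (.zigzag_left 3) rfl rfl) ((ht.shift 2 0).append (.of_strandsAbove rfl))) ?_
  refine trans (v := shiftWord 0 t ++ [𝐔 0, 𝐀 1]) (tangle_left (N := 2) ht) ?_
  refine trans (v := shiftWord 0 t ++ []) (above (ht.shift 0 0)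
    (move [] [] (.zigzag_left 0) rfl rfl)) ?_
  simpa [shiftWord_zero] using refl ht

theorem rotate_rotateCW_word (ht : Stacks 2 t 2) :
    WordIso 2 (𝐔 2 :: 𝐔 1 :: (shiftWord 2 t ++ [𝐀 3, 𝐀 0])) t 2 := by
  refine trans (v := 𝐔 1 :: 𝐔 4 :: (shiftWord 2 t ++ [𝐀 3, 𝐀 0]))
    (below (move [] [] (.exchange .cup .cup 1 1) rfl rfl).symm
      ((ht.shift 2 2).append (.of_strandsAbove rfl))) ?_
  refine trans (v := 𝐔 1 :: 𝐔 4 :: (shiftWord 2 t ++ [𝐀 0, 𝐀 1]))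
    (prepend [𝐔 1, 𝐔 4] (above (ht.shift 2 2)
      (move [] [] (.exchange .cap .cap 0 1) rfl rfl).symm)) ?_
  refine trans (v := 𝐔 1 :: 𝐔 4 :: 𝐀 0 :: (shiftWord 0 t ++ [𝐀 1]))
    (prepend [𝐔 1, 𝐔 4] (tangle_left (N := 6) ht).symm) ?_
  refine trans (v := 𝐔 1 :: 𝐀 0 :: 𝐔 2 :: (shiftWord 0 t ++ [𝐀 1]))
    (below (move [𝐔 1] [] (.exchange .cap .cup 0 2) rfl rfl).symm
      ((ht.shift 0 2).append (.of_strandsAbove rfl))) ?_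
  refine trans (v := 𝐔 2 :: (shiftWord 0 t ++ [𝐀 1]))
    (below (move [] [𝐔 2] (.zigzag_right 0) rfl rfl) ((ht.shift 0 2).append (.of_strandsAbove rfl))) ?_
  refine trans (v := shiftWord 0 t ++ [𝐔 2, 𝐀 1]) (tangle_right (N := 2) ht).symm ?_
  refine trans (v := shiftWord 0 t ++ []) (above (ht.shift 0 0)
    (move [] [] (.zigzag_right 1) rfl rfl)) ?_
  simpa [shiftWord_zero] using refl ht

/-- Turning the crossing around the maximum reverses its sign. An inserted zigzag then supplies the
arcs joining the two summands on the right-hand side. -/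
theorem rotate_prod_top_word (ht : Stacks 2 t 2) :
    WordIso 2 (𝐔 2 :: (shiftWord 1 t ++ [𝐗 s 1, 𝐀 0]))
      (𝐔 1 :: 𝐗 (!s) 0 :: 𝐔 4 :: (shiftWord 3 t ++ [𝐀 2, 𝐀 1])) 2 := by
  refine trans (v := 𝐔 2 :: (shiftWord 1 t ++ [𝐗 (!s) 0, 𝐀 1]))
    (prepend [𝐔 2] (above (ht.shift 1 1) (move [] [] (.slide_cap s 0) rfl rfl))) ?_
  refine trans (v := 𝐔 2 :: (shiftWord 1 t ++ [𝐔 1, 𝐀 2, 𝐗 (!s) 0, 𝐀 1]))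
    (prepend [𝐔 2] (above (ht.shift 1 1)
      (move [] [𝐗 (!s) 0, 𝐀 1] (.zigzag_left 1) rfl rfl).symm)) ?_
  refine trans (v := 𝐔 2 :: 𝐔 1 :: (shiftWord 3 t ++ [𝐀 2, 𝐗 (!s) 0, 𝐀 1]))
    (prepend [𝐔 2] (tangle_left (N := 4) ht).symm) ?_
  refine trans (v := 𝐔 1 :: 𝐔 4 :: (shiftWord 3 t ++ [𝐀 2, 𝐗 (!s) 0, 𝐀 1]))
    (below (move [] [] (.exchange .cup .cup 1 1) rfl rfl).symm
      ((ht.shift 3 1).append (.of_strandsAbove rfl))) ?_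
  refine trans (v := 𝐔 1 :: 𝐔 4 :: (shiftWord 3 t ++ [𝐗 (!s) 0, 𝐀 2, 𝐀 1]))
    (prepend [𝐔 1, 𝐔 4] (above (ht.shift 3 1)
      (move [] [𝐀 1] (.exchange (.cross !s) .cap 0 0) rfl rfl).symm)) ?_
  refine trans (v := 𝐔 1 :: 𝐔 4 :: 𝐗 (!s) 0 :: (shiftWord 3 t ++ [𝐀 2, 𝐀 1]))
    (prepend [𝐔 1, 𝐔 4] (tangle_left (N := 6) ht).symm) ?_
  exact below (move [𝐔 1] [] (.exchange (.cross !s) .cup 0 2) rfl rfl).symm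
    ((ht.shift 3 1).append (.of_strandsAbove rfl))

theorem rotate_prod_bottom_word (ht : Stacks 2 t 2) :
    WordIso 2 (𝐔 2 :: 𝐗 s 1 :: (shiftWord 1 t ++ [𝐀 0]))
      (𝐔 1 :: 𝐔 2 :: (shiftWord 1 t ++ [𝐀 0, 𝐗 (!s) 2, 𝐀 1])) 2 := by
  refine trans (v := 𝐔 1 :: 𝐗 (!s) 2 :: (shiftWord 1 t ++ [𝐀 0]))
    (below (u := [𝐔 2, 𝐗 s 1]) (v := [𝐔 1, 𝐗 (!s) 2]) (k := 4) ?_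
      ((ht.shift 1 1).append (.of_strandsAbove rfl))) ?_
  · cases s
    · exact (move [] [] (.slide_cup true 1) rfl rfl).symm
    · exact (move [] [] (.slide_cup false 1) rfl rfl).symm
  refine trans (v := 𝐔 1 :: 𝐗 (!s) 2 :: 𝐔 2 :: 𝐀 3 :: (shiftWord 1 t ++ [𝐀 0]))
    (below (move [𝐔 1, 𝐗 (!s) 2] [] (.zigzag_left 2) rfl rfl).symm
      ((ht.shift 1 1).append (.of_strandsAbove rfl))) ?_
  refine trans (v := 𝐔 1 :: 𝐔 2 :: 𝐗 (!s) 4 :: 𝐀 3 :: (shiftWord 1 t ++ [𝐀 0]))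
    (below (move [𝐔 1] [𝐀 3] (.exchange .cup (.cross !s) 2 0) rfl rfl).symm
      ((ht.shift 1 1).append (.of_strandsAbove rfl))) ?_
  refine trans (v := 𝐔 1 :: 𝐔 2 :: 𝐗 (!s) 4 :: (shiftWord 1 t ++ [𝐀 3, 𝐀 0]))
    (prepend [𝐔 1, 𝐔 2, 𝐗 (!s) 4] (tangle_right (N := 6) ht).symm) ?_
  refine trans (v := 𝐔 1 :: 𝐔 2 :: (shiftWord 1 t ++ [𝐗 (!s) 4, 𝐀 3, 𝐀 0]))
    (prepend [𝐔 1, 𝐔 2] (tangle_right (N := 6) ht).symm) ?_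
  refine trans (v := 𝐔 1 :: 𝐔 2 :: (shiftWord 1 t ++ [𝐗 (!s) 4, 𝐀 0, 𝐀 1]))
    (prepend [𝐔 1, 𝐔 2] (above (ht.shift 1 3)
      (move [𝐗 (!s) 4] [] (.exchange .cap .cap 0 1) rfl rfl).symm)) ?_
  exact prepend [𝐔 1, 𝐔 2] (above (ht.shift 1 3)
      (move [] [𝐀 1] (.exchange .cap (.cross !s) 0 2) rfl rfl).symm)

theorem rotate_sum_left_word (ht : Stacks 2 t 2) :
    WordIso 2 (𝐔 2 :: 𝐔 2 :: 𝐗 s 1 :: (shiftWord 3 t ++ [𝐀 2, 𝐀 0]))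
      (𝐗 (!s) 0 :: 𝐔 2 :: (shiftWord 1 t ++ [𝐀 0])) 2 := by
  refine trans (v := 𝐔 2 :: 𝐔 2 :: 𝐗 s 1 :: (shiftWord 3 t ++ [𝐀 0, 𝐀 0]))
    (prepend [𝐔 2, 𝐔 2, 𝐗 s 1] (above (ht.shift 3 1)
      (move [] [] (.exchange .cap .cap 0 0) rfl rfl).symm)) ?_
  refine trans (v := 𝐔 2 :: 𝐔 2 :: 𝐗 s 1 :: 𝐀 0 :: (shiftWord 1 t ++ [𝐀 0]))
    (prepend [𝐔 2, 𝐔 2, 𝐗 s 1] (tangle_left (N := 6) ht).symm) ?_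
  refine below (v := [𝐗 (!s) 0, 𝐔 2]) (u := [𝐔 2, 𝐔 2, 𝐗 s 1, 𝐀 0]) ?_
    ((ht.shift 1 1).append (.of_strandsAbove rfl))
  refine trans (v := [𝐔 2, 𝐔 2, 𝐗 (!s) 0, 𝐀 1]) (move [𝐔 2, 𝐔 2] [] (.slide_cap s 0) rfl rfl) ?_
  refine trans (v := [𝐔 2, 𝐗 (!s) 0, 𝐔 2, 𝐀 1])
    (move [𝐔 2] [𝐀 1] (.exchange (.cross !s) .cup 0 0) rfl rfl).symm ?_
  refine trans (v := [𝐔 2, 𝐗 (!s) 0])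
    (move [𝐔 2, 𝐗 (!s) 0] [] (.zigzag_right 1) rfl rfl) ?_
  exact (move [] [] (.exchange (.cross !s) .cup 0 0) rfl rfl).symm

theorem rotate_sum_right_word (ht : Stacks 2 t 2) :
    WordIso 2 (𝐔 2 :: 𝐔 2 :: (shiftWord 1 t ++ [𝐗 s 3, 𝐀 2, 𝐀 0]))
      (𝐔 2 :: (shiftWord 1 t ++ [𝐀 0, 𝐗 (!s) 0])) 2 := by
  refine trans (v := 𝐔 2 :: 𝐔 4 :: (shiftWord 1 t ++ [𝐗 s 3, 𝐀 2, 𝐀 0]))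
    (below (move [] [] (.exchange .cup .cup 2 0) rfl rfl).symm
      ((ht.shift 1 3).append (.of_strandsAbove rfl))) ?_
  refine trans (v := 𝐔 2 :: (shiftWord 1 t ++ [𝐔 4, 𝐗 s 3, 𝐀 2, 𝐀 0]))
    (prepend [𝐔 2] (tangle_right (N := 4) ht).symm) ?_
  refine prepend [𝐔 2] (above (ht.shift 1 1) ?_)
  refine trans (v := [𝐔 4, 𝐗 (!s) 2, 𝐀 3, 𝐀 0]) (move [𝐔 4] [𝐀 0] (.slide_cap s 2) rfl rfl) ?_
  refine trans (v := [𝐔 4, 𝐗 (!s) 2, 𝐀 0, 𝐀 1])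
    (move [𝐔 4, 𝐗 (!s) 2] [] (.exchange .cap .cap 0 1) rfl rfl).symm ?_
  refine trans (v := [𝐔 4, 𝐀 0, 𝐗 (!s) 0, 𝐀 1])
    (move [𝐔 4] [𝐀 1] (.exchange .cap (.cross !s) 0 0) rfl rfl).symm ?_
  refine trans (v := [𝐀 0, 𝐔 2, 𝐗 (!s) 0, 𝐀 1])
    (move [] [𝐗 (!s) 0, 𝐀 1] (.exchange .cap .cup 0 2) rfl rfl).symm ?_
  refine trans (v := [𝐀 0, 𝐗 (!s) 0, 𝐔 2, 𝐀 1])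
    (move [𝐀 0] [𝐀 1] (.exchange (.cross !s) .cup 0 0) rfl rfl).symm ?_
  exact move [𝐀 0, 𝐗 (!s) 0] [] (.zigzag_right 1) rfl rfl

/-- With the crossings at the bottom and on the right turned around their extrema, the three added
crossings lie on one strand that runs entirely over or entirely under the tangle. Sliding it across
by `passing_comm` brings the crossings together below the tangle, where a second and a first
Reidemeister move remove them; what remains is the rotated tangle. -/
theorem rotateCW_word (ht : Stacks 2 t 2) :
    WordIso 2 (𝐔 1 :: 𝐗 s 0 :: (t ++ [𝐗 (!s) 2, 𝐀 1, 𝐗 s 0]))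
      (𝐔 0 :: (shiftWord 1 t ++ [𝐀 2])) 2 := by
  have hp := passing_comm s ht
  refine trans (v := 𝐔 0 :: 𝐗 (!s) 1 :: (t ++ [𝐗 (!s) 2, 𝐀 1, 𝐗 s 0]))
    (below (u := [𝐔 1, 𝐗 s 0]) (v := [𝐔 0, 𝐗 (!s) 1]) (k := 4) ?_
      ((ht.widen 2).append (.of_strandsAbove rfl))) ?_
  · cases s
    · exact (move [] [] (.slide_cup true 0) rfl rfl).symm
    · exact (move [] [] (.slide_cup false 0) rfl rfl).symm
  refine trans (v := 𝐔 0 :: 𝐗 (!s) 1 :: (t ++ [𝐗 s 1, 𝐗 s 0, 𝐀 2]))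
    (prepend [𝐔 0, 𝐗 (!s) 1] (above (ht.widen 2) ?_)) ?_
  · refine trans (v := [𝐗 s 1, 𝐀 2, 𝐗 s 0])
      (below (u := [𝐗 (!s) 2, 𝐀 1]) (v := [𝐗 s 1, 𝐀 2]) (k := 2) ?_ (.of_strandsAbove rfl)) ?_
    · cases s
      · exact move [] [] (.slide_cap true 1) rfl rfl
      · exact move [] [] (.slide_cap false 1) rfl rfl
    · exact (move [𝐗 s 1] [] (.exchange (.cross s) .cap 0 0) rfl rfl).symm
  refine trans (v := 𝐔 0 :: 𝐗 (!s) 1 :: 𝐗 s 1 :: 𝐗 s 0 :: (shiftWord 1 t ++ [𝐀 2])) ?_ ?_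
  · refine prepend (k := 4) [𝐔 0, 𝐗 (!s) 1] ?_
    simpa [passing] using below (hp.widen 1) (t := [𝐀 2]) (.of_strandsAbove (m := 2) rfl)
  refine below (u := [𝐔 0, 𝐗 (!s) 1, 𝐗 s 1, 𝐗 s 0]) (v := [𝐔 0]) ?_
    ((ht.shift 1 1).append (.of_strandsAbove rfl))
  refine trans (v := [𝐔 0, 𝐗 s 0]) ?_ (move [] [] (.reidemeister_one_cup s 0) rfl rfl)
  cases s
  · exact move [𝐔 0] [𝐗 false 0] (.reidemeister_two true 1) rfl rfl
  · exact move [𝐔 0] [𝐗 true 0] (.reidemeister_two false 1) rfl rfl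

/-- By `hs`, a crossing added on the right becomes a crossing of the opposite sign at position 1
above the tangle, under a maximum at position 2. Both sides are thus the tangle topped by a braid on
three strands, and the two braids differ by a third Reidemeister move. -/
theorem braid_word (ht : Stacks 2 t 2) :
    WordIso 2 (𝐔 1 :: (t ++ [𝐗 s 0, 𝐗 (!s) 2, 𝐀 1, 𝐗 s 0]))
      (𝐔 1 :: 𝐔 1 :: (t ++ [𝐗 (!s) 2, 𝐀 1, 𝐗 s 0, 𝐗 (!s) 2, 𝐀 1])) 2 := by
  have hs : WordIso 4 [𝐗 (!s) 2, 𝐀 1] [𝐗 s 1, 𝐀 2] 2 := by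
    cases s
    · exact move [] [] (.slide_cap true 1) rfl rfl
    · exact move [] [] (.slide_cap false 1) rfl rfl
  refine trans (v := 𝐔 1 :: (t ++ [𝐗 s 1, 𝐗 s 0, 𝐗 s 1, 𝐀 2]))
    (prepend [𝐔 1] (above (ht.widen 2) ?_)) (.symm ?_)
  · refine trans (v := [𝐗 s 0, 𝐗 s 1, 𝐀 2, 𝐗 s 0])
      (prepend [𝐗 s 0] (below hs (t := [𝐗 s 0]) (.of_strandsAbove rfl))) ?_
    refine trans (v := [𝐗 s 0, 𝐗 s 1, 𝐗 s 0, 𝐀 2])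
      (move [𝐗 s 0, 𝐗 s 1] [] (.exchange (.cross s) .cap 0 0) rfl rfl).symm ?_
    exact move [] [𝐀 2] (.reidemeister_three s 0) rfl rfl
  refine trans (v := 𝐔 1 :: 𝐔 3 :: (t ++ [𝐗 (!s) 2, 𝐀 1, 𝐗 s 0, 𝐗 (!s) 2, 𝐀 1]))
    (below (move [] [] (.exchange .cup .cup 1 0) rfl rfl).symm
      ((ht.widen 4).append (.of_strandsAbove rfl))) ?_
  refine prepend (k := 4) [𝐔 1] ?_
  refine trans (v := t ++ [𝐔 3, 𝐗 (!s) 2, 𝐀 1, 𝐗 s 0, 𝐗 (!s) 2, 𝐀 1]) ?_ (above (ht.widen 2) ?_)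
  · simpa [shiftWord_zero] using (tangle_right (N := 4) (c := 0) ht
      (b := [𝐗 (!s) 2, 𝐀 1, 𝐗 s 0, 𝐗 (!s) 2, 𝐀 1]) (q := .cup) (x := 3) (M := 2)).symm
  refine trans (v := [𝐔 3, 𝐗 s 1, 𝐀 2, 𝐗 s 0, 𝐗 s 1, 𝐀 2])
    (prepend [𝐔 3] ((hs.widen 2).append (prepend [𝐗 s 0] hs))) ?_
  refine trans (v := [𝐔 3, 𝐗 s 1, 𝐗 s 0, 𝐀 2, 𝐗 s 1, 𝐀 2])
    (move [𝐔 3, 𝐗 s 1] [𝐗 s 1, 𝐀 2] (.exchange (.cross s) .cap 0 0) rfl rfl).symm ?_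
  refine trans (v := [𝐗 s 1, 𝐔 3, 𝐗 s 0, 𝐀 2, 𝐗 s 1, 𝐀 2])
    (move [] [𝐗 s 0, 𝐀 2, 𝐗 s 1, 𝐀 2] (.exchange (.cross s) .cup 1 0) rfl rfl).symm ?_
  refine trans (v := [𝐗 s 1, 𝐗 s 0, 𝐔 3, 𝐀 2, 𝐗 s 1, 𝐀 2])
    (move [𝐗 s 1] [𝐀 2, 𝐗 s 1, 𝐀 2] (.exchange (.cross s) .cup 0 1) rfl rfl).symm ?_
  exact move [𝐗 s 1, 𝐗 s 0] [𝐗 s 1, 𝐀 2] (.zigzag_right 2) rfl rfl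

/-- The two bracketings differ only in the heights of their pieces, so exchanges suffice. -/
theorem sum_assoc_word {a b c : List Slice} (ha : Stacks 2 a 2) (hb : Stacks 2 b 2)
    (hc : Stacks 2 c 2) :
    WordIso 2 (𝐔 1 :: 𝐔 1 :: (a ++ (shiftWord 2 b ++ (𝐀 1 :: (shiftWord 2 c ++ [𝐀 1])))))
      (𝐔 1 :: (a ++ (𝐔 3 :: (shiftWord 2 b ++ (shiftWord 4 c ++ [𝐀 3, 𝐀 1]))))) 2 := by
  refine trans (v := 𝐔 1 :: 𝐔 3 :: (a ++ (shiftWord 2 b ++ (𝐀 1 :: (shiftWord 2 c ++ [𝐀 1])))))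
    (below (move [] [] (.exchange .cup .cup 1 0) rfl rfl).symm
      ((ha.widen 4).append ((hb.shift 2 2).append ((Stacks.cap (i := 1) (r := 3)
        ((hc.shift 2 0).append (.of_strandsAbove rfl))))))) (prepend (k := 4) [𝐔 1] ?_)
  refine trans (v := 𝐔 3 :: (a ++ (shiftWord 2 b ++ (shiftWord 4 c ++ [𝐀 3, 𝐀 1]))))
    (prepend [𝐔 3] (above (ha.widen 4) (above (hb.shift 2 2) ?_))) ?_
  · refine trans (tangle_left (N := 6) (x := 2) (y := 4) hc) (above (hc.shift 4 0) ?_)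
    exact move [] [] (.exchange .cap .cap 1 0) rfl rfl
  · have := tangle_right (c := 0) (x := 3) (q := .cup) (N := 4) (M := 2)
      (b := shiftWord 2 b ++ (shiftWord 4 c ++ [𝐀 3, 𝐀 1])) ha
      ((hb.shift 2 2).append ((hc.shift 4 0).append (.of_strandsAbove rfl)))
    simpa [shiftWord_zero] using this.symm

theorem zero_sum_word (ht : Stacks 2 t 2) :
    WordIso 2 (𝐔 1 :: 𝐀 0 :: 𝐔 0 :: (shiftWord 2 t ++ [𝐀 1])) t 2 := by
  refine trans (v := 𝐔 0 :: (shiftWord 2 t ++ [𝐀 1]))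
    (below (move [] [𝐔 0] (.zigzag_right 0) rfl rfl) ((ht.shift 2 0).append (.of_strandsAbove rfl))) ?_
  refine trans (v := shiftWord 0 t ++ [𝐔 0, 𝐀 1]) (tangle_left (N := 2) ht) ?_
  refine trans (v := shiftWord 0 t ++ []) (above (ht.shift 0 0)
    (move [] [] (.zigzag_left 0) rfl rfl)) ?_
  simpa [shiftWord_zero] using refl ht

end TangleDiagram

/-! ### Operations on tangles up to isotopy -/

theorem shiftWord_nil (a : ℕ) : shiftWord a [] = [] := rfl

theorem shiftWord_cons (a i : ℕ) (p : Piece) (w : List Slice) :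
    shiftWord a (⟨p, i⟩ :: w) = ⟨p, a + i⟩ :: shiftWord a w := rfl

/-- Tangles: diagrams up to isotopy. -/
def Tangle : Type := Quotient (Relation.EqvGen.setoid (Diagram.Move (n := 2) (m := 2)))

namespace Tangle

open TangleDiagram WordIso

/-- The tangle of a diagram. -/
def mk (T : TangleDiagram) : Tangle := Quotient.mk _ T

theorem mk_eq {T S : TangleDiagram} : mk T = mk S ↔ WordIso 2 T.word S.word 2 :=
  ⟨fun h => of_isotopic (Quotient.exact h), fun h => Quotient.sound h.isotopic⟩

theorem mk_congr {T S : TangleDiagram} (h : T.word = S.word) : mk T = mk S := by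
  obtain ⟨_, _⟩ := T
  obtain ⟨_, _⟩ := S
  subst h
  rfl

/-- The action on tangles of an operation on diagrams. -/
def map (f : TangleDiagram → TangleDiagram)
    (hf : ∀ T S, WordIso 2 T.word S.word 2 → WordIso 2 (f T).word (f S).word 2) :
    Tangle → Tangle :=
  Quotient.map f fun T S h => (hf T S (of_isotopic h)).isotopic

/-- Multiplication by `[±1]` at the top. -/
def top (s : Bool) : Tangle → Tangle :=
  map (fun T => (one s).prod T) fun _ _ h => h.append (refl (one s).fits)

/-- Multiplication by `[±1]` at the bottom. -/
def bottom (s : Bool) : Tangle → Tangle :=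
  map (fun T => T.prod (one s)) fun _ _ h => (refl (one s).fits).append h

theorem sum_congr {T T' S S' : TangleDiagram} (h : WordIso 2 T.word T'.word 2)
    (h' : WordIso 2 S.word S'.word 2) : WordIso 2 (T.sum S).word (T'.sum S').word 2 :=
  prepend (k := 4) [⟨.cup, 1⟩] ((h.widen 2).append ((h'.shift 2 0).append (refl (.of_strandsAbove rfl))))

/-- Addition of `[±1]` on the right. -/
def right (s : Bool) : Tangle → Tangle :=
  map (fun T => T.sum (one s)) fun _ _ h => sum_congr h (refl (one s).fits)

/-- Addition of `[±1]` on the left. -/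
def left (s : Bool) : Tangle → Tangle :=
  map (fun T => (one s).sum T) fun _ _ h => sum_congr (refl (one s).fits) h

theorem rotate_congr {T T' : TangleDiagram} (h : WordIso 2 T.word T'.word 2) :
    WordIso 2 T.rotate.word T'.rotate.word 2 :=
  prepend (k := 4) [⟨.cup, 2⟩] ((h.shift 1 1).append (refl (.of_strandsAbove rfl)))

theorem inverse_congr {T T' : TangleDiagram} (h : WordIso 2 T.word T'.word 2) :
    WordIso 2 T.inverse.word T'.inverse.word 2 :=
  rotate_congr (WordIso.mirror h)

/-- Rotation counterclockwise by a right angle. -/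
def rot : Tangle → Tangle := map rotate fun _ _ h => rotate_congr h

/-- Rotation clockwise by a right angle. -/
def rotCW : Tangle → Tangle :=
  map rotateCW fun _ _ h => prepend (k := 4) [⟨.cup, 0⟩] ((h.shift 1 1).append (refl (.of_strandsAbove rfl)))

/-- The mirror image. -/
def mir : Tangle → Tangle := map TangleDiagram.mirror fun _ _ h => WordIso.mirror h

theorem ind {P : Tangle → Prop} (h : ∀ T, P (mk T)) (x : Tangle) : P x := Quotient.ind h x

theorem left_mk (s : Bool) (T : TangleDiagram) : left s (mk T) = mk ((one s).sum T) := rfl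

variable (s : Bool) (x : Tangle)

theorem rotCW_rot : rotCW (rot x) = x := by
  induction x using ind with
  | h T =>
    refine mk_eq.2 ?_
    simpa [rotateCW, rotate, shiftWord_append, shiftWord_shiftWord, shiftWord_cons, shiftWord_nil]
      using rotateCW_rotate_word T.fits

theorem rot_rotCW : rot (rotCW x) = x := by
  induction x using ind with
  | h T =>
    refine mk_eq.2 ?_
    simpa [rotateCW, rotate, shiftWord_append, shiftWord_shiftWord, shiftWord_cons, shiftWord_nil]
      using rotate_rotateCW_word T.fits

theorem rot_top : rot (top s x) = left (!s) (rot x) := by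
  induction x using ind with
  | h T =>
    refine mk_eq.2 ?_
    simpa [prod, one, sum, rotate, shiftWord_append, shiftWord_shiftWord, shiftWord_cons,
      shiftWord_nil] using rotate_prod_top_word s T.fits

theorem rot_bottom : rot (bottom s x) = right (!s) (rot x) := by
  induction x using ind with
  | h T =>
    refine mk_eq.2 ?_
    simpa [prod, one, sum, rotate, shiftWord_append, shiftWord_shiftWord, shiftWord_cons,
      shiftWord_nil] using rotate_prod_bottom_word s T.fits

theorem rot_left : rot (left s x) = bottom (!s) (rot x) := by
  induction x using ind with
  | h T =>
    refine mk_eq.2 ?_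
    simpa [prod, one, sum, rotate, shiftWord_append, shiftWord_shiftWord, shiftWord_cons,
      shiftWord_nil] using rotate_sum_left_word s T.fits

theorem rot_right : rot (right s x) = top (!s) (rot x) := by
  induction x using ind with
  | h T =>
    refine mk_eq.2 ?_
    simpa [prod, one, sum, rotate, shiftWord_append, shiftWord_shiftWord, shiftWord_cons,
      shiftWord_nil] using rotate_sum_right_word s T.fits

theorem rotCW_eq : rotCW x = top s (right (!s) (bottom s x)) := by
  induction x using ind with
  | h T =>
    refine Eq.symm (mk_eq.2 ?_)
    simpa [prod, one, sum, rotateCW, shiftWord_cons, shiftWord_nil] using rotateCW_word s T.fits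

theorem top_right_top : top s (right (!s) (top s x)) = right (!s) (top s (right (!s) x)) := by
  induction x using ind with
  | h T =>
    refine mk_eq.2 ?_
    simpa [prod, one, sum, shiftWord_cons, shiftWord_nil] using braid_word s T.fits

theorem mir_top : mir (top s x) = top (!s) (mir x) := by
  induction x using ind with
  | h T => exact mk_congr (by simp [TangleDiagram.mirror, prod, one, mirrorWord, Piece.mirror])

theorem mir_bottom : mir (bottom s x) = bottom (!s) (mir x) := by
  induction x using ind with
  | h T => exact mk_congr (by simp [TangleDiagram.mirror, prod, one, mirrorWord, Piece.mirror])

theorem mir_right : mir (right s x) = right (!s) (mir x) := by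
  induction x using ind with
  | h T =>
    exact mk_congr (by
      simp [TangleDiagram.mirror, sum, one, mirrorWord, shiftWord, Piece.mirror])

theorem mir_left : mir (left s x) = left (!s) (mir x) := by
  induction x using ind with
  | h T =>
    exact mk_congr (by
      simp [TangleDiagram.mirror, sum, one, mirrorWord, shiftWord, Piece.mirror])

theorem mir_rot : mir (rot x) = rot (mir x) := by
  induction x using ind with
  | h T =>
    exact mk_congr (by
      simp [TangleDiagram.mirror, rotate, mirrorWord, shiftWord, Piece.mirror])

theorem mir_mir : mir (mir x) = x := by
  induction x using ind with
  | h T =>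
    refine mk_eq.2 ?_
    have : mirrorWord (mirrorWord T.word) = T.word := by
      have : ∀ p : Piece, p.mirror.mirror = p := by rintro (_ | _ | s) <;> simp [Piece.mirror]
      simp [mirrorWord, Function.comp_def, this]
    simpa only [TangleDiagram.mirror, this] using refl T.fits

theorem top_top : top (!s) (top s x) = x := by
  induction x using ind with
  | h T =>
    refine mk_eq.2 ?_
    simpa [prod, one] using above (m := 2) T.fits (move [] [] (.reidemeister_two s 0) rfl rfl)

theorem bottom_bottom : bottom s (bottom (!s) x) = x := by
  induction x using ind with
  | h T =>
    refine mk_eq.2 ?_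
    simpa [prod, one] using below (k := 2) (move [] [] (.reidemeister_two s 0) rfl rfl) T.fits

theorem top_bottom_comm (t : Bool) : top s (bottom t x) = bottom t (top s x) := by
  induction x using ind with
  | h T => exact mk_congr (by simp [prod])

theorem top_zero : top s (mk zero) = mk zero :=
  mk_eq.2 (move [⟨.cap, 0⟩] [] (.reidemeister_one_cup s 0) rfl rfl)

theorem bottom_zero : bottom s (mk zero) = mk zero :=
  mk_eq.2 (move [] [⟨.cup, 0⟩] (.reidemeister_one_cap s 0) rfl rfl)

theorem rot_zero : rot (mk zero) = mk infty :=
  mk_eq.2 (WordIso.trans (v := [⟨.cup, 1⟩, ⟨.cap, 0⟩])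
    (move [] [⟨.cup, 1⟩, ⟨.cap, 0⟩] (.zigzag_right 1) rfl rfl)
    (move [] [] (.zigzag_right 0) rfl rfl))

theorem rot_infty : rot (mk infty) = mk zero :=
  mk_eq.2 (move [] [] (.exchange .cap .cup 0 0) rfl rfl).symm

theorem top_infty : top s (mk infty) = bottom s (mk infty) := rfl

theorem sum_assoc (A B C : TangleDiagram) : mk ((A.sum B).sum C) = mk (A.sum (B.sum C)) := by
  refine mk_eq.2 ?_
  simpa [sum, shiftWord_append, shiftWord_shiftWord, shiftWord_cons,
      shiftWord_nil] using sum_assoc_word A.fits B.fits C.fits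

theorem zero_sum (A : TangleDiagram) : mk (zero.sum A) = mk A := by
  refine mk_eq.2 ?_
  simpa [sum, zero, shiftWord_cons, shiftWord_nil] using zero_sum_word A.fits

end Tangle

/-! ### Relations obtained by rotation -/

namespace Tangle

open TangleDiagram WordIso

variable (s : Bool) (x : Tangle)

theorem rotCW_top : rotCW (top s x) = right (!s) (rotCW x) := by
  rw [← rotCW_rot (right (!s) (rotCW x)), rot_right, rot_rotCW, Bool.not_not]

theorem rotCW_right : rotCW (right s x) = bottom (!s) (rotCW x) := by
  rw [← rotCW_rot (bottom (!s) (rotCW x)), rot_bottom, rot_rotCW, Bool.not_not]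

theorem rotCW_bottom : rotCW (bottom s x) = left (!s) (rotCW x) := by
  rw [← rotCW_rot (left (!s) (rotCW x)), rot_left, rot_rotCW, Bool.not_not]

/-- This is `rotCW_eq` conjugated by `rot`: turning the whole picture moves each crossing to the
next side. -/
theorem rotCW_eq_left_top_right : rotCW x = left (!s) (top s (right (!s) x)) := by
  rw [← rot_rotCW (rotCW x), rotCW_eq s (rotCW x), rot_top, rot_right, rot_bottom, rot_rotCW,
    Bool.not_not]

theorem rotCW_eq_right_bottom_left : rotCW x = right (!s) (bottom s (left (!s) x)) := by
  nth_rw 1 [← rotCW_rot x]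
  rw [rotCW_eq s (rot x), rotCW_top, rotCW_right, rotCW_bottom, rotCW_rot, Bool.not_not]

/-- The braid relation turned by a right angle. -/
theorem top_left_top : top s (left (!s) (top s x)) = left (!s) (top s (left (!s) x)) := by
  have := congrArg rot (top_right_top s (rotCW x))
  simpa only [rot_top, rot_right, rot_rotCW, Bool.not_not] using this.symm

theorem top_top' : top s (top (!s) x) = x := by
  simpa using top_top (!s) x

theorem right_right : right s (right (!s) x) = x := by
  rw [← rot_rotCW x, ← Bool.not_not s, ← rot_bottom, ← rot_bottom, bottom_bottom]

theorem right_right' : right (!s) (right s x) = x := by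
  simpa using right_right (!s) x

theorem left_left : left s (left (!s) x) = x := by
  rw [← rot_rotCW x, ← Bool.not_not s, ← rot_top, ← rot_top, top_top']

theorem top_injective : Function.Injective (top s) :=
  Function.LeftInverse.injective (top_top s)

theorem right_injective : Function.Injective (right s) :=
  Function.LeftInverse.injective (right_right' s)

theorem right_left_comm (t : Bool) : right s (left t x) = left t (right s x) := by
  have := congrArg rot (top_bottom_comm (!t) (rotCW x) (!s))
  simpa only [rot_top, rot_bottom, rot_rotCW, Bool.not_not] using this.symm

theorem rotCW_zero : rotCW (mk zero) = mk infty := by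
  rw [← rot_infty, rotCW_rot]

theorem rotCW_infty : rotCW (mk infty) = mk zero := by
  rw [← rot_zero, rotCW_rot]

theorem right_infty : right s (mk infty) = mk infty := by
  rw [← rot_zero, ← Bool.not_not s, ← rot_bottom, bottom_zero]

theorem left_infty : left s (mk infty) = mk infty := by
  rw [← rot_zero, ← Bool.not_not s, ← rot_top, top_zero]

theorem right_zero_eq_left_zero : right s (mk zero) = left s (mk zero) := by
  rw [← rot_infty, ← Bool.not_not s, ← rot_bottom, ← rot_top, top_infty]

/-- Both sides are the single crossing. -/
theorem right_zero : right s (mk zero) = top s (mk infty) :=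
  zero_sum (one s)

/-- The classes of the diagrams in twist form. -/
inductive IsRat : Tangle → Prop
  | zero : IsRat (mk zero)
  | infty : IsRat (mk infty)
  | top (s : Bool) {x : Tangle} (h : IsRat x) : IsRat (top s x)
  | bottom (s : Bool) {x : Tangle} (h : IsRat x) : IsRat (bottom s x)
  | right (s : Bool) {x : Tangle} (h : IsRat x) : IsRat (right s x)
  | left (s : Bool) {x : Tangle} (h : IsRat x) : IsRat (left s x)

theorem isRat_mk_of_isTwistForm {T : TangleDiagram} (h : T.IsTwistForm) : IsRat (mk T) := by
  induction h with
  | zero => exact .zero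
  | infty => exact .infty
  | sum_right s _ ih => exact .right s ih
  | sum_left s _ ih => exact .left s ih
  | prod_bottom s _ ih => exact .bottom s ih
  | prod_top s _ ih => exact .top s ih

theorem isRat_mk_iff {T : TangleDiagram} : IsRat (mk T) ↔ T.IsRational := by
  constructor
  · suffices ∀ x, IsRat x → ∃ S : TangleDiagram, S.IsTwistForm ∧ x = mk S by
      intro h
      obtain ⟨S, hS, h⟩ := this _ h
      exact ⟨S, hS, (mk_eq.1 h).isotopic⟩
    intro x h
    induction h with
    | zero => exact ⟨_, .zero, rfl⟩
    | infty => exact ⟨_, .infty, rfl⟩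
    | top s _ ih => obtain ⟨S, hS, rfl⟩ := ih; exact ⟨_, .prod_top s hS, rfl⟩
    | bottom s _ ih => obtain ⟨S, hS, rfl⟩ := ih; exact ⟨_, .prod_bottom s hS, rfl⟩
    | right s _ ih => obtain ⟨S, hS, rfl⟩ := ih; exact ⟨_, .sum_right s hS, rfl⟩
    | left s _ ih => obtain ⟨S, hS, rfl⟩ := ih; exact ⟨_, .sum_left s hS, rfl⟩
  · rintro ⟨S, hS, h⟩
    rw [mk_eq.2 (of_isotopic h)]
    exact isRat_mk_of_isTwistForm hS

/-! ### Flypes of rational tangles -/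

/-- A crossing glued to one side of the tangle may be moved to the opposite side. -/
def IsFlypable : Prop := (∀ s, top s x = bottom s x) ∧ ∀ s, right s x = left s x

variable {s x}

/-- The operations at top and bottom commute and are invertible, so equality for one sign gives
equality of the inverses. -/
theorem top_not_eq_bottom_not (h : top s x = bottom s x) : top (!s) x = bottom (!s) x := by
  have h₁ : bottom (!s) (bottom s x) = x := by simpa using bottom_bottom (!s) x
  nth_rw 1 [← h₁]
  rw [← h, top_bottom_comm, top_top]

theorem right_not_eq_left_not (h : right s x = left s x) : right (!s) x = left (!s) x := by
  have h₁ : left (!s) (left s x) = x := by simpa using left_left (!s) x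
  nth_rw 1 [← h₁]
  rw [← h, right_left_comm, right_right']

theorem top_top_comm (s t : Bool) (x : Tangle) : top s (top t x) = top t (top s x) := by
  by_cases h : t = s
  · rw [h]
  · obtain rfl : t = !s := by revert h; cases s <;> cases t <;> simp
    rw [top_top, top_top']

theorem right_right_comm (s t : Bool) (x : Tangle) : right s (right t x) = right t (right s x) := by
  by_cases h : t = s
  · rw [h]
  · obtain rfl : t = !s := by revert h; cases s <;> cases t <;> simp
    rw [right_right, right_right']

/-- After `right (!s)` is applied to both sides, each becomes `rotCW x`: the left one by the braid
relation and `rotCW_eq`, the right one by `rotCW_eq_right_bottom_left`. Flypability of `x` is what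
matches the inner crossings. -/
theorem IsFlypable.top_eq_bottom_right (h : IsFlypable x) (s : Bool) :
    top s (right (!s) x) = bottom s (right (!s) x) := by
  apply right_injective (!s)
  have h₁ := (rotCW_eq s x).symm.trans (rotCW_eq_right_bottom_left s x)
  rw [← h.1, ← h.2] at h₁
  rw [← h₁, top_right_top]

theorem IsFlypable.right_eq_left_top (h : IsFlypable x) (s : Bool) :
    right (!s) (top s x) = left (!s) (top s x) := by
  apply top_injective s
  have h₁ := (rotCW_eq s x).symm.trans (rotCW_eq_left_top_right s x)
  rw [← h.1, h.2] at h₁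
  rw [h₁, top_left_top]

theorem IsFlypable.top (h : IsFlypable x) (t : Bool) : IsFlypable (top t x) := by
  refine ⟨fun s => ?_, fun s => ?_⟩
  · rw [← top_bottom_comm, ← h.1, top_top_comm]
  · have h₁ := h.right_eq_left_top t
    by_cases hs : s = t
    · simpa [hs] using right_not_eq_left_not h₁
    · obtain rfl : s = !t := by revert hs; cases s <;> cases t <;> simp
      exact h₁

theorem IsFlypable.right (h : IsFlypable x) (t : Bool) : IsFlypable (right t x) := by
  refine ⟨fun s => ?_, fun s => ?_⟩
  · have h₁ := h.top_eq_bottom_right (!t)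
    rw [Bool.not_not] at h₁
    by_cases hs : s = t
    · simpa [hs] using top_not_eq_bottom_not h₁
    · obtain rfl : s = !t := by revert hs; cases s <;> cases t <;> simp
      exact h₁
  · rw [← right_left_comm, ← h.2, right_right_comm]

theorem isFlypable_zero : IsFlypable (mk zero) :=
  ⟨fun s => by rw [top_zero, bottom_zero], right_zero_eq_left_zero⟩

theorem isFlypable_infty : IsFlypable (mk infty) :=
  ⟨top_infty, fun s => by rw [right_infty, left_infty]⟩

/-- The flype property itself permits replacing `bottom` by `top` and `left` by `right` in the
induction, so two closure properties suffice. -/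
theorem IsRat.isFlypable (h : IsRat x) : IsFlypable x := by
  induction h with
  | zero => exact isFlypable_zero
  | infty => exact isFlypable_infty
  | top s _ ih => exact ih.top s
  | bottom s _ ih => exact ih.1 s ▸ ih.top s
  | right s _ ih => exact ih.right s
  | left s _ ih => exact ih.2 s ▸ ih.right s

theorem IsRat.bottom_eq_top (h : IsRat x) (s : Bool) : Tangle.bottom s x = Tangle.top s x :=
  (h.isFlypable.1 s).symm

theorem IsRat.left_eq_right (h : IsRat x) (s : Bool) : Tangle.left s x = Tangle.right s x :=
  (h.isFlypable.2 s).symm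

theorem IsRat.rot (h : IsRat x) : IsRat (rot x) := by
  induction h with
  | zero => rw [rot_zero]; exact .infty
  | infty => rw [rot_infty]; exact .zero
  | top s _ ih => rw [rot_top]; exact .left _ ih
  | bottom s _ ih => rw [rot_bottom]; exact .right _ ih
  | right s _ ih => rw [rot_right]; exact .top _ ih
  | left s _ ih => rw [rot_left]; exact .bottom _ ih

theorem IsRat.rotCW_eq_top (h : IsRat x) (s : Bool) :
    rotCW x = Tangle.top s (Tangle.right (!s) (Tangle.top s x)) := by
  rw [rotCW_eq s, h.bottom_eq_top]

/-- The sign in `rotCW_eq_top` is free; with `!s` there, the braid relation gives this form. -/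
theorem IsRat.rotCW_eq_right (h : IsRat x) (s : Bool) :
    rotCW x = Tangle.right s (Tangle.top (!s) (Tangle.right s x)) := by
  simpa using (h.rotCW_eq_top (!s)).trans (top_right_top (!s) x)

theorem IsRat.rotCW (h : IsRat x) : IsRat (rotCW x) := by
  rw [h.rotCW_eq_top true]
  exact .top _ (.right _ (.top _ h))

/-- The expressions of `rotCW` for the two signs are inverse to each other letter by letter. Hence a
half turn fixes every rational tangle. -/
theorem IsRat.rotCW_rotCW (h : IsRat x) : Tangle.rotCW (Tangle.rotCW x) = x := by
  have h₁ := right_right true (Tangle.top true (Tangle.right false x))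
  have h₂ := right_right true x
  rw [h.rotCW.rotCW_eq_right true, h.rotCW_eq_right false]
  simp only [Bool.not_true, Bool.not_false] at h₁ h₂ ⊢
  rw [h₁]
  have h₃ := top_top true (Tangle.right false x)
  rw [Bool.not_true] at h₃
  rw [h₃, h₂]

theorem IsRat.rotCW_eq_rot (h : IsRat x) : Tangle.rotCW x = Tangle.rot x := by
  conv_rhs => rw [← h.rotCW_rotCW, rot_rotCW]

theorem IsRat.rot_rot (h : IsRat x) : Tangle.rot (Tangle.rot x) = x := by
  rw [← h.rotCW_eq_rot, rot_rotCW]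

theorem mir_zero : mir (mk zero) = mk zero := rfl

theorem mir_infty : mir (mk infty) = mk infty := rfl

theorem IsRat.mir (h : IsRat x) : IsRat (mir x) := by
  induction h with
  | zero => rw [mir_zero]; exact .zero
  | infty => rw [mir_infty]; exact .infty
  | top s _ ih => rw [mir_top]; exact .top _ ih
  | bottom s _ ih => rw [mir_bottom]; exact .bottom _ ih
  | right s _ ih => rw [mir_right]; exact .right _ ih
  | left s _ ih => rw [mir_left]; exact .left _ ih

/-! ### Reduction to crossings of one sign -/

/-- The tangles created from `[0]` and `[∞]` by additions of, and multiplications by, the crossings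
that contribute one and the same sign to the fraction. -/
inductive IsSigned (s : Bool) : Tangle → Prop
  | zero : IsSigned s (mk zero)
  | infty : IsSigned s (mk infty)
  | top {x : Tangle} (h : IsSigned s x) : IsSigned s (top s x)
  | right {x : Tangle} (h : IsSigned s x) : IsSigned s (right s x)

theorem IsSigned.isRat (h : IsSigned s x) : IsRat x := by
  induction h with
  | zero => exact .zero
  | infty => exact .infty
  | top _ ih => exact .top _ ih
  | right _ ih => exact .right _ ih

/-- A quarter turn exchanges `[0]` with `[∞]`, and gluing on top with gluing on a side, reversing
the sign of each glued crossing. -/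
theorem IsSigned.rotCW (h : IsSigned s x) : IsSigned (!s) (rotCW x) := by
  induction h with
  | zero => rw [rotCW_zero]; exact .infty
  | infty => rw [rotCW_infty]; exact .zero
  | top h ih => rw [rotCW_top]; exact .right ih
  | right h ih => rw [rotCW_right, h.isRat.rotCW.bottom_eq_top]; exact .top ih

theorem IsSigned.top_not (h : IsSigned s x) :
    IsSigned s (Tangle.top (!s) x) ∨ IsSigned (!s) (Tangle.top (!s) x) := by
  cases h with
  | zero => exact .inr (.top .zero)
  | infty => exact .inr (.top .infty)
  | top h => rw [top_top]; exact .inl h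
  | @right y h =>
      -- In `rotCW (top s y) = top (!s) (right s (top (!s) (top s y)))` the innermost pair cancels,
      -- so the tangle in question is a quarter turn of `top s y`.
      have := (h.isRat.top s).rotCW_eq_top (!s)
      rw [top_top, Bool.not_not] at this
      rw [← this]
      exact .inr h.top.rotCW

theorem IsSigned.right_not (h : IsSigned s x) :
    IsSigned s (Tangle.right (!s) x) ∨ IsSigned (!s) (Tangle.right (!s) x) := by
  cases h with
  | zero => exact .inr (.right .zero)
  | infty => exact .inr (.right .infty)
  | right h => rw [right_right']; exact .inl h
  | @top y h =>
      have := (h.isRat.right s).rotCW_eq_right (!s)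
      rw [right_right', Bool.not_not] at this
      rw [← this]
      exact .inr h.right.rotCW

/-- The sign may change along the construction: each new crossing either agrees with the current
sign or is absorbed by `top_not` or `right_not`. -/
theorem IsRat.exists_isSigned (h : IsRat x) : ∃ s, IsSigned s x := by
  have ht (s : Bool) {x : Tangle} : (∃ s, IsSigned s x) → ∃ s', IsSigned s' (Tangle.top s x) := by
    rintro ⟨t, h⟩
    by_cases hs : s = t
    · exact ⟨t, hs ▸ h.top⟩
    · obtain rfl : s = !t := by revert hs; cases s <;> cases t <;> simp
      exact h.top_not.elim (fun h => ⟨_, h⟩) fun h => ⟨_, h⟩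
  have hr (s : Bool) {x : Tangle} : (∃ s, IsSigned s x) → ∃ s', IsSigned s' (Tangle.right s x) := by
    rintro ⟨t, h⟩
    by_cases hs : s = t
    · exact ⟨t, hs ▸ h.right⟩
    · obtain rfl : s = !t := by revert hs; cases s <;> cases t <;> simp
      exact h.right_not.elim (fun h => ⟨_, h⟩) fun h => ⟨_, h⟩
  induction h with
  | zero => exact ⟨true, .zero⟩
  | infty => exact ⟨true, .infty⟩
  | top s _ ih => exact ht s ih
  | bottom s h ih => exact h.bottom_eq_top s ▸ ht s ih
  | right s _ ih => exact hr s ih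
  | left s h ih => exact h.left_eq_right s ▸ hr s ih

/-! ### Continued fractions with terms of one sign -/

/-- The inverse of a tangle. -/
def inv : Tangle → Tangle := map inverse fun _ _ h => inverse_congr h

theorem inv_mk (T : TangleDiagram) : inv (mk T) = mk T.inverse := rfl

theorem inv_eq (x : Tangle) : inv x = Tangle.rot (Tangle.mir x) := by
  induction x using ind with
  | h T => rfl

theorem inv_right (s : Bool) (x : Tangle) : inv (right s x) = top s (inv x) := by
  rw [inv_eq, inv_eq, mir_right, rot_right, Bool.not_not]

theorem IsRat.inv (h : IsRat x) : IsRat (inv x) := by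
  rw [inv_eq]
  exact h.mir.rot

theorem IsRat.inv_inv (h : IsRat x) : Tangle.inv (Tangle.inv x) = x := by
  rw [inv_eq, inv_eq, mir_rot, mir_mir, h.rot_rot]

theorem sum_twists_zero (s : Bool) (T : TangleDiagram) : mk ((twists s 0).sum T) = mk T :=
  zero_sum T

/-- In the sum the last twist lies between the other twists and `T`. Associativity attaches it to
the left of `T`, and a flype carries it to the right. -/
theorem sum_twists_succ (s : Bool) (n : ℕ) (T : TangleDiagram) (h : IsRat (mk T)) :
    mk ((twists s (n + 1)).sum T) = right s (mk ((twists s n).sum T)) := by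
  induction n generalizing T with
  | zero =>
      refine (sum_assoc _ _ _).trans ?_
      rw [sum_twists_zero, sum_twists_zero, ← left_mk, h.left_eq_right]
  | succ n ih =>
      have h₁ (n : ℕ) : mk ((twists s (n + 1)).sum T) = mk ((twists s n).sum ((one s).sum T)) :=
        sum_assoc _ _ _
      rw [h₁ (n + 1), ih _ (h.left s), ← h₁ n]

theorem isRat_sum_twists (s : Bool) (n : ℕ) (T : TangleDiagram) (h : IsRat (mk T)) :
    IsRat (mk ((twists s n).sum T)) := by
  induction n with
  | zero => rwa [sum_twists_zero]
  | succ n ih => rw [sum_twists_succ _ _ _ h]; exact .right _ ih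

theorem isRat_twists (s : Bool) (n : ℕ) : IsRat (mk (twists s n)) := by
  induction n with
  | zero => exact .zero
  | succ n ih => exact .right s ih

/-- The integer with the given sign and absolute value. -/
def signed : Bool → ℕ → ℤ
  | true, n => n
  | false, n => -n

theorem ofInt_signed (s : Bool) (n : ℕ) : ofInt (signed s n) = twists s n := by
  match s, n with
  | true, n => rfl
  | false, 0 => rfl
  | false, n + 1 => rfl

/-- The continued fraction whose terms have the given sign and absolute values. -/
def signedFrac (s : Bool) (n : ℕ) (l : List ℕ) : TangleDiagram :=
  contFrac (signed s n) (l.map (signed s))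

theorem signedFrac_nil (s : Bool) (n : ℕ) : signedFrac s n [] = twists s n := ofInt_signed s n

theorem signedFrac_cons (s : Bool) (n b : ℕ) (l : List ℕ) :
    signedFrac s n (b :: l) = (twists s n).sum (signedFrac s b l).inverse := by
  rw [← ofInt_signed]
  rfl

theorem isRat_signedFrac (s : Bool) (n : ℕ) (l : List ℕ) : IsRat (mk (signedFrac s n l)) := by
  induction l generalizing n with
  | nil => rw [signedFrac_nil]; exact isRat_twists s n
  | cons b l ih => rw [signedFrac_cons]; exact isRat_sum_twists s n _ (ih b).inv

theorem signedFrac_succ (s : Bool) (n : ℕ) (l : List ℕ) :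
    mk (signedFrac s (n + 1) l) = right s (mk (signedFrac s n l)) := by
  cases l with
  | nil => rw [signedFrac_nil, signedFrac_nil]; rfl
  | cons b l =>
      rw [signedFrac_cons, signedFrac_cons, sum_twists_succ _ _ _ (isRat_signedFrac s b l).inv]

theorem signedFrac_zero_cons (s : Bool) (b : ℕ) (l : List ℕ) :
    mk (signedFrac s 0 (b :: l)) = inv (mk (signedFrac s b l)) := by
  rw [signedFrac_cons, sum_twists_zero, inv_mk]

/-- The tangle identity behind this is `top s x = 1 / ([±1] + 1 / x)` for rational `x`. -/
theorem top_signedFrac (s : Bool) (n : ℕ) (l : List ℕ) :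
    top s (mk (signedFrac s n l)) = mk (signedFrac s 0 (1 :: n :: l)) := by
  rw [signedFrac_zero_cons, ← zero_add 1, signedFrac_succ, inv_right, signedFrac_zero_cons,
    (isRat_signedFrac s n l).inv_inv]

/-- Gluing on the right increases the first term; gluing on top either increases the second term or
prepends two terms, or it is applied to `[0]` or `[∞]`. The parity of the length is therefore
preserved. -/
theorem IsSigned.exists_signedFrac (h : IsSigned s x) :
    x = mk TangleDiagram.infty ∨
      ∃ n l, Even l.length ∧ (∀ k ∈ l, 0 < k) ∧ x = mk (signedFrac s n l) := by
  induction h with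
  | zero => exact .inr ⟨0, [], by simp, by simp, by rw [signedFrac_nil]; rfl⟩
  | infty => exact .inl rfl
  | right h ih =>
      obtain rfl | ⟨n, l, hl, hp, rfl⟩ := ih
      · exact .inl (right_infty s)
      · exact .inr ⟨n + 1, l, hl, hp, (signedFrac_succ s n l).symm⟩
  | top h ih =>
      refine .inr ?_
      obtain rfl | ⟨n, l, hl, hp, rfl⟩ := ih
      -- Multiplying `[∞]` by a crossing gives that crossing, which is the first integer tangle of
      -- its sign.
      · refine ⟨1, [], by simp, by simp, ?_⟩
        rw [← right_zero, signedFrac_nil]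
        rfl
      · obtain rfl | hn := Nat.eq_zero_or_pos n
        · cases l with
          | nil =>
              refine ⟨0, [], by simp, by simp, ?_⟩
              rw [signedFrac_nil]
              exact top_zero s
          | cons b l =>
              -- The tangle is `1 / y` with `y` beginning with `b`, and a crossing on top of `1 / y`
              -- is one added to `y`.
              refine ⟨0, (b + 1) :: l, hl, by simpa using fun k hk => hp k (by simp [hk]), ?_⟩
              rw [signedFrac_zero_cons, signedFrac_zero_cons, signedFrac_succ, inv_right]
        -- Here `n` becomes an inner term, which must be positive; this is why a zero first term is
        -- treated separately.
        · refine ⟨0, 1 :: n :: l, by simpa [Nat.even_add_one] using hl, ?_, top_signedFrac s n l⟩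
          simpa [hn] using hp

theorem isCanonicalForm_signedFrac (s : Bool) (n : ℕ) (l : List ℕ) (hl : Even l.length)
    (hp : ∀ k ∈ l, 0 < k) : (signedFrac s n l).IsCanonicalForm := by
  refine ⟨signed s n, l.map (signed s), rfl, by simpa, ?_⟩
  cases s
  · exact .inr ⟨by simp [signed], by simpa [signed] using hp⟩
  · exact .inl ⟨by simp [signed], by simpa [signed] using hp⟩

end Tangle

/-! ### Checkerboard colouring and alternation -/

/-- In every crossing of the stack of slices the overcrossing strand lies in the same way with
respect to the checkerboard colouring of the regions. -/
def IsShaded (e : Bool) (w : List Slice) : Prop :=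
  ∀ t i, (⟨.cross t, i⟩ : Slice) ∈ w → (t ^^ i.bodd) = e

namespace IsShaded

variable {e : Bool} {u v w : List Slice}

theorem append (hu : IsShaded e u) (hv : IsShaded e v) : IsShaded e (u ++ v) := fun t i h =>
  (List.mem_append.1 h).elim (hu t i) (hv t i)

theorem cup_cons (i : ℕ) (hw : IsShaded e w) : IsShaded e (⟨.cup, i⟩ :: w) := fun t j h =>
  hw t j (by simpa using h)

theorem cap_cons (i : ℕ) (hw : IsShaded e w) : IsShaded e (⟨.cap, i⟩ :: w) := fun t j h =>
  hw t j (by simpa using h)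

theorem nil : IsShaded e [] := fun _ _ h => by simp at h

/-- Shifting by an odd number of strands exchanges the two colours. -/
theorem shift (a : ℕ) (hw : IsShaded e w) : IsShaded (e ^^ a.bodd) (shiftWord a w) := by
  intro t i h
  obtain ⟨⟨p, j⟩, hj, h⟩ := List.mem_map.1 h
  simp only [Slice.mk.injEq] at h
  obtain ⟨rfl, rfl⟩ := h
  rw [← hw t j hj, Nat.bodd_add]
  cases t <;> cases a.bodd <;> cases j.bodd <;> rfl

theorem mirror (hw : IsShaded e w) : IsShaded (!e) (mirrorWord w) := by
  intro t i h
  obtain ⟨⟨p, j⟩, hj, h⟩ := List.mem_map.1 h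
  simp only [Slice.mk.injEq] at h
  obtain ⟨hp, rfl⟩ := h
  cases p with
  | cup => cases hp
  | cap => cases hp
  | cross s =>
      cases hp
      rw [← hw s j hj, Bool.not_xor]

end IsShaded

/-- The colour of the region on the left when walking along a strand. -/
def WalkState.colour (x : WalkState) : Bool := x.pos.bodd ^^ x.up

/-- Past a piece the position changes by an even number, since every piece has an even number of
strands below and above. At a maximum or minimum both the parity of the position and the direction
change. -/
theorem Diagram.WalkStep.colour_eq {n m : ℕ} {D : Diagram n m} {x y : WalkState}
    (h : D.WalkStep x y) : x.colour = y.colour := by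
  have hp (p : Piece) : p.inputs.bodd = false ∧ p.outputs.bodd = false := by
    cases p <;> simp [Piece.inputs, Piece.outputs]
  cases h <;> simp [WalkState.colour, Nat.bodd_add, hp]

/-- For a fixed shading, the colour on the left of the walker decides between over and under.
Leaving and arriving through the same corner are opposite directions, which accounts for the
negation absent from `isOver_arriving`. -/
theorem Corner.isOver_leaving (e s : Bool) (k i : ℕ) (c : Corner) (h : (s ^^ i.bodd) = e) :
    c.isOver s = !(e ^^ (c.leaving k i).colour) := by
  subst h
  cases c <;> cases s <;> simp [Corner.isOver, Corner.leaving, WalkState.colour]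

theorem Corner.isOver_arriving (e s : Bool) (k i : ℕ) (c : Corner) (h : (s ^^ i.bodd) = e) :
    c.isOver s = (e ^^ (c.arriving k i).colour) := by
  subst h
  cases c <;> cases s <;> simp [Corner.isOver, Corner.arriving, WalkState.colour]

/-- The colour on the left is constant between consecutive crossings, and the same colour means
opposite things on leaving and on arriving. -/
theorem IsShaded.isAlternating {n m : ℕ} {D : Diagram n m} {e : Bool} (h : IsShaded e D.word) :
    D.IsAlternating := by
  intro k i k' i' s s' c c' hk hk' hw
  have hc : (c.leaving k i).colour = (c'.arriving k' i').colour := by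
    generalize c.leaving k i = x, c'.arriving k' i' = y at hw
    induction hw with
    | refl => rfl
    | tail _ h ih => exact ih.trans h.colour_eq
  rw [c.isOver_leaving e s k i (h _ _ (List.mem_of_getElem? hk)),
    c'.isOver_arriving e s' k' i' (h _ _ (List.mem_of_getElem? hk')), hc]
  simp

/-! ### Shading of continued fractions and closures -/

namespace TangleDiagram

open WordIso Tangle

theorem isShaded_sum {e : Bool} {T S : TangleDiagram} (hT : IsShaded e T.word)
    (hS : IsShaded e S.word) : IsShaded e (T.sum S).word :=
  .cup_cons _ (hT.append (.append (by simpa using hS.shift 2) (.cap_cons _ .nil)))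

theorem isShaded_one (s : Bool) : IsShaded s (one s).word := by
  intro t i h
  simp only [one, List.mem_singleton, Slice.mk.injEq, Piece.cross.injEq] at h
  simp [h]

/-- The mirror image and the shift by one strand inside the rotation each reverse the shading, so
together they preserve it. -/
theorem isShaded_inverse {e : Bool} {T : TangleDiagram} (hT : IsShaded e T.word) :
    IsShaded e T.inverse.word :=
  .cup_cons _ (.append (by simpa [TangleDiagram.mirror] using hT.mirror.shift 1)
    (.cap_cons _ .nil))

theorem isShaded_twists (s : Bool) (n : ℕ) : IsShaded s (twists s n).word := by
  induction n with
  | zero => exact .cap_cons _ (.cup_cons _ .nil)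
  | succ n ih => exact isShaded_sum ih (isShaded_one s)

theorem isShaded_signedFrac (s : Bool) (n : ℕ) (l : List ℕ) :
    IsShaded s (signedFrac s n l).word := by
  induction l generalizing n with
  | nil => rw [signedFrac_nil]; exact isShaded_twists s n
  | cons b l ih =>
      rw [signedFrac_cons]
      exact isShaded_sum (isShaded_twists s n) (isShaded_inverse (ih b))

theorem isShaded_numerator {e : Bool} {T : TangleDiagram} (hT : IsShaded e T.word) :
    IsShaded e T.numerator.word :=
  .cup_cons _ (hT.append (.cap_cons _ .nil))

/-- The closing arc on the left shifts the tangle by one strand and so reverses the shading, which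
is harmless: either value of `e` gives an alternating diagram. -/
theorem isShaded_denominator {e : Bool} {T : TangleDiagram} (hT : IsShaded e T.word) :
    IsShaded (!e) T.denominator.word :=
  .cup_cons _ (.cup_cons _ (.append (by simpa using hT.shift 1) (.cap_cons _ (.cap_cons _ .nil))))

theorem numerator_isotopic {T S : TangleDiagram} (h : mk T = mk S) :
    T.numerator.Isotopic S.numerator :=
  isotopic (prepend (k := 2) [⟨.cup, 0⟩] ((mk_eq.1 h).append (refl (.of_strandsAbove rfl))))

theorem denominator_isotopic {T S : TangleDiagram} (h : mk T = mk S) :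
    T.denominator.Isotopic S.denominator :=
  isotopic (prepend (k := 4) [⟨.cup, 0⟩, ⟨.cup, 2⟩]
    (((mk_eq.1 h).shift 1 1).append (refl (.of_strandsAbove rfl))))

theorem numerator_infty_isotopic : infty.numerator.Isotopic zero.denominator := by
  refine (isotopic ?_ : zero.denominator.Isotopic infty.numerator).symm
  refine WordIso.trans (v := [⟨.cup, 0⟩, ⟨.cup, 1⟩, ⟨.cap, 2⟩, ⟨.cap, 0⟩])
    (move [⟨.cup, 0⟩] [⟨.cup, 1⟩, ⟨.cap, 2⟩, ⟨.cap, 0⟩] (.zigzag_right 1) rfl rfl) ?_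
  exact move [⟨.cup, 0⟩] [⟨.cap, 0⟩] (.zigzag_left 1) rfl rfl

theorem denominator_infty_isotopic : infty.denominator.Isotopic zero.numerator := by
  refine isotopic (WordIso.trans (v := [⟨.cup, 0⟩, ⟨.cup, 2⟩, ⟨.cap, 0⟩, ⟨.cap, 0⟩])
    (move [⟨.cup, 0⟩, ⟨.cup, 2⟩] [] (.exchange .cap .cap 0 0) rfl rfl).symm ?_)
  exact (move [⟨.cup, 0⟩] [⟨.cap, 0⟩] (.exchange .cap .cup 0 0) rfl rfl).symm

theorem IsRational.exists_closure {T : TangleDiagram} (hT : T.IsRational) {L : LinkDiagram}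
    (hL : L.Isotopic T.numerator ∨ L.Isotopic T.denominator) :
    ∃ s n l, Even l.length ∧ (∀ k ∈ l, 0 < k) ∧ (L.Isotopic (signedFrac s n l).numerator ∨
      L.Isotopic (signedFrac s n l).denominator) := by
  obtain ⟨s, hs⟩ := (isRat_mk_iff.2 hT).exists_isSigned
  obtain h | ⟨n, l, hl, hp, h⟩ := hs.exists_signedFrac
  -- The tangle `[∞]` is replaced by `[0]`, with numerator and denominator interchanged; hence
  -- `hL.symm`. The sign is immaterial, as there are no twists.
  · refine ⟨true, 0, [], by simp, by simp, ?_⟩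
    rw [signedFrac_nil]
    exact hL.symm.imp
      (fun h' => h'.trans _ _ _ ((denominator_isotopic h).trans _ _ _ denominator_infty_isotopic))
      (fun h' => h'.trans _ _ _ ((numerator_isotopic h).trans _ _ _ numerator_infty_isotopic))
  · exact ⟨s, n, l, hl, hp, hL.imp (fun h' => h'.trans _ _ _ (numerator_isotopic h))
      (fun h' => h'.trans _ _ _ (denominator_isotopic h))⟩

end TangleDiagram

/-- Every rational knot or link `L` (given by a diagram) is alternating; more precisely, it has an
alternating diagram that is the numerator or denominator closure of an alternating rational tangle
in canonical form. -/
theorem corollary2 (L : LinkDiagram) (hL : LinkDiagram.IsRational L) :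
    LinkDiagram.IsAlternatingLink L ∧
      ∃ T : TangleDiagram,
        TangleDiagram.IsRational T ∧ TangleDiagram.IsCanonicalForm T ∧ T.IsAlternating ∧
          ∃ K : LinkDiagram,
            (K = TangleDiagram.numerator T ∨ K = TangleDiagram.denominator T) ∧
              L.Isotopic K ∧ K.IsAlternating := by
  obtain ⟨T, hT, hL⟩ := hL
  obtain ⟨s, n, l, hl, hp, h⟩ := hT.exists_closure hL
  have hs := TangleDiagram.isShaded_signedFrac s n l
  obtain ⟨K, hK, hLK, ha⟩ : ∃ K : LinkDiagram,
      (K = (Tangle.signedFrac s n l).numerator ∨ K = (Tangle.signedFrac s n l).denominator) ∧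
        L.Isotopic K ∧ K.IsAlternating :=
    h.elim (fun h => ⟨_, .inl rfl, h, (TangleDiagram.isShaded_numerator hs).isAlternating⟩)
      fun h => ⟨_, .inr rfl, h, (TangleDiagram.isShaded_denominator hs).isAlternating⟩
  exact ⟨⟨K, hLK, ha⟩, Tangle.signedFrac s n l,
    Tangle.isRat_mk_iff.1 (Tangle.isRat_signedFrac s n l),
    Tangle.isCanonicalForm_signedFrac s n l hl hp, hs.isAlternating, K, hK, hLK, ha⟩
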